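/- Let $P$ be a probability distribution with full finite support, let $k>0$ and $0<\varepsilon\le\varepsilon'$. Write $\mathrm{poi}(r,i)=e^{-r}r^i/i!$, let $y_j$ be the distinct probabilities of $P$ and $N_j$ the number of domain elements of probability $y_j$. Logarithms and suprema may be infinite, and $0\cdot\infty=0$. **Upper bound.** Let $\Delta(P,k,\varepsilon)$ be $$\inf_{c}\max\Big\{\sup_{h}\ \inf_{t\le 0}\sum_{j,x}h_j(x)\log\sum_i e^{tc_{i,j}}\mathrm{poi}(kx,i)\,,\ \inf_{t\ge 0}\sum_j N_j\log\sum_i e^{tc_{i,j}}\mathrm{poi}(ky_j,i)\Big\},$$ where $c$ ranges over real coefficients $c_{i,j}$ and $h$ over families of finitely supported functions $h_j:[0,\infty)\to[0,\infty)$ with $\sum_x h_j(x)=N_j$ for all $j$ and $\sum_{j,x}h_j(x)|x-y_j|\ge\varepsilon$. For $\alpha\le 0$, $u\in[0,1]$ and real $\kappa_{i,j}$ let $$G(\alpha,u,\kappa)=\varepsilon\alpha(1-u)+\sum_j\Big(uN_j\log\sum_i e^{(1-u)\kappa_{i,j}}\mathrm{poi}(ky_j,i)+(1-u)N_j\sup_{x\ge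 0}\big(-\alpha|x-y_j|+\log\sum_i e^{-u\kappa_{i,j}}\mathrm{poi}(kx,i)\big)\Big).$$ Let $\alpha\le0$, $u\in[0,1]$, and for each $j$ let $q_j\in(0,1)$ and $0\le x_{1,j}<y_j<x_{2,j}$, be optimal: with $\kappa_{i,j}=\log\frac{q_j\mathrm{poi}(kx_{1,j},i)+(1-q_j)\mathrm{poi}(kx_{2,j},i)}{\mathrm{poi}(ky_j,i)}$, the point $(\alpha,u,\kappa)$ minimizes $G$ over all $\alpha\le 0$, $u\in[0,1]$ and real coefficients. **Conditional coin flips.** Now index the domain elements of $P$ by $a$, and let $y_a,q_a,x_{1,a},x_{2,a}$ be the values for the class of $a$. Put $q_{1,a}=q_a$ and $q_{2,a}=1-q_a$. Independently for each $a$, let $r_a=1$ with probability $q_{1,a}$ and $r_a=2$ with probability $q_{2,a}$, and give $a$ the mass $x_{r_a,a}$ (the total mass need not be $1$). Let $W$ be the event $\sum_a|x_{r_a,a}-y_a|\in[\varepsilon,\varepsilon']$, and assume that it has positive probability. Let $\mathcal Q_{[\varepsilon,\varepsilon']}$ be this random distribution conditioned on $W$. Let $P(h)$ and $\mathcal Q_{[\varepsilon,\varepsilon']}(h)$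 be the probabilities of the histogram $h$ (the number of occurrences of each domain element) under $\mathrm{Poi}(k)$ samples, meaning that an element of mass $p$ is seen an independent $\mathrm{Poi}(kp)$ number of times. **Chernoff factors.** For $v\in[0,1]$ let $F(v)=\sum_{h:\,\mathcal Q_{[\varepsilon,\varepsilon']}(h)>0}P(h)^v\mathcal Q_{[\varepsilon,\varepsilon']}(h)^{1-v}$, and let $v$ be a minimizer of $F$ on $[0,1]$. Put $$ch_1=\frac{\min\big\{\Pr_{h\leftarrow P}[\log\frac{\mathcal Q_{[\varepsilon,\varepsilon']}(h)}{P(h)}>0],\ \Pr_{h\leftarrow\mathcal Q_{[\varepsilon,\varepsilon']}}[\log\frac{\mathcal Q_{[\varepsilon,\varepsilon']}(h)}{P(h)}<0]\big\}}{\min_{[0,1]}F},$$ $$\pi_{b,a}=\sum_i\frac{\mathrm{poi}(ky_a,i)^v\,q_{b,a}\,\mathrm{poi}(kx_{b,a},i)}{(q_{1,a}\mathrm{poi}(kx_{1,a},i)+q_{2,a}\mathrm{poi}(kx_{2,a},i))^v}\quad(b=1,2),\qquad ch_2=\frac{\sum_{r\in W}\prod_a\pi_{r_a,a}}{\inf_{s\ge0}e^{-s\varepsilon}\prod_a\sum_{b=1,2}e^{s|x_{b,a}-y_a|}\pi_{b,a}}.$$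 **Claim.** Every tester that decides, by an arbitrary and possibly randomized function of the histogram of $\mathrm{Poi}(k)$ samples, between $P$ and $\mathcal Q_{[\varepsilon,\varepsilon']}$ has failure probability (the maximum of its type 1 and type 2 errors) at least $$e^{G(\alpha,u,\kappa)}\cdot ch_1\cdot ch_2\cdot e^{\alpha(\varepsilon'-\varepsilon)},$$ and at least $e^{\Delta(P,k,\varepsilon)}\cdot ch_1\cdot ch_2\cdot e^{\alpha(\varepsilon'-\varepsilon)}$. -/

import Mathlib

open scoped NNReal ENNReal

noncomputable section

namespace IdentityTesting

/-- `poi(r, i)`: the probability that a Poisson variable of mean `r` equals `i`. -/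
def poi (r : ℝ) (i : ℕ) : ℝ := Real.exp (-r) * r ^ i / (i.factorial : ℝ)

theorem poi_eq_poissonMeasure (r : ℝ≥0) (i : ℕ) :
    poi (r : ℝ) i = (ProbabilityTheory.poissonMeasure r).real {i} := by
  rw [ProbabilityTheory.poissonMeasure_real_singleton]; rfl

variable {ι : Type*} [Fintype ι]

/-! ### The optimization problem -/

/-- `P` is a probability distribution with support the finite set `ι`. -/
def IsHypothesis (P : ι → ℝ) : Prop := (∀ a, 0 < P a) ∧ ∑ a, P a = 1

/-- The distinct probabilities `y_j` of `P`. -/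
def levels (P : ι → ℝ) : Finset ℝ := Finset.univ.image P

/-- The number of domain elements of probability `y` under `P`. -/
def mult (P : ι → ℝ) (y : ℝ) : ℕ := (Finset.univ.filter fun a => P a = y).card

/-- `log ∑ᵢ exp (t cᵢ) poi(r, i)`, which is `⊤` if the series diverges. -/
def logMgf (t : ℝ) (c : ℕ → ℝ) (r : ℝ) : EReal :=
  ENNReal.log (∑' i : ℕ, ENNReal.ofReal (Real.exp (t * c i) * poi r i))

/-- The relaxed (not necessarily integral) histograms of alternatives at `ℓ₁` distance at least `ε`
from `P`: `h y x` is the amount of domain elements that have probability `y` under `P` and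
probability `x` under the alternative. -/
def IsFarHistogram (P : ι → ℝ) (ε : ℝ) (h : ℝ → (ℝ≥0 →₀ ℝ≥0)) : Prop :=
  ε ≤ ∑ y ∈ levels P, (h y).sum (fun x w => (w : ℝ) * |(x : ℝ) - y|) ∧
  ∀ y ∈ levels P, (h y).sum (fun _ w => (w : ℝ)) = (mult P y : ℝ)

/-- The best Chernoff bound on the log of the probability that the semilinear tester with
coefficients `c i y` accepts the alternative with histogram `h`. -/
def logTypeTwo (P : ι → ℝ) (k : ℝ) (c : ℕ → ℝ → ℝ) (h : ℝ → (ℝ≥0 →₀ ℝ≥0)) : EReal :=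
  ⨅ t : Set.Iic (0 : ℝ), ∑ y ∈ levels P,
    (h y).sum (fun x w => ((w : ℝ) : EReal) * logMgf t (fun i => c i y) (k * x))

/-- The best Chernoff bound on the log of the probability that the semilinear tester with
coefficients `c i y` rejects `P`. -/
def logTypeOne (P : ι → ℝ) (k : ℝ) (c : ℕ → ℝ → ℝ) : EReal :=
  ⨅ t : Set.Ici (0 : ℝ), ∑ y ∈ levels P,
    ((mult P y : ℝ) : EReal) * logMgf t (fun i => c i y) (k * y)

/-- `Δ(P, k, ε)`: the best Chernoff bound on the log failure probability of semilinear testers. -/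
def Delta (P : ι → ℝ) (k ε : ℝ) : EReal :=
  ⨅ c : ℕ → ℝ → ℝ,
    max (⨆ h : {h : ℝ → (ℝ≥0 →₀ ℝ≥0) // IsFarHistogram P ε h}, logTypeTwo P k c h)
      (logTypeOne P k c)

/-- The merged objective: a function of `α`, `u` and the coefficients `κ i y`. -/
def mergedObjective (P : ι → ℝ) (k ε α u : ℝ) (κ : ℕ → ℝ → ℝ) : EReal :=
  ((ε * α * (1 - u) : ℝ) : EReal) + ∑ y ∈ levels P,
    (((u * mult P y : ℝ) : EReal) * logMgf (1 - u) (fun i => κ i y) (k * y) +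
      (((1 - u) * mult P y : ℝ) : EReal) *
        ⨆ x : ℝ≥0, (((-α * |(x : ℝ) - y| : ℝ) : EReal) + logMgf (-u) (fun i => κ i y) (k * x)))

/-- The parameters `α`, `u`, and, for each level `y = y_j` of the hypothesis, `q_j`, `x_{1,j}`,
`x_{2,j}`. -/
structure Params where
  α : ℝ
  u : ℝ
  q : ℝ → ℝ
  x₁ : ℝ → ℝ
  x₂ : ℝ → ℝ

/-- The two-point form of the coefficients,
`κ_{i,j} = log ((q_j poi(k x_{1,j}, i) + (1 - q_j) poi(k x_{2,j}, i)) / poi(k y_j, i))`. -/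
def Params.kappa (θ : Params) (k : ℝ) (i : ℕ) (y : ℝ) : ℝ :=
  Real.log ((θ.q y * poi (k * θ.x₁ y) i + (1 - θ.q y) * poi (k * θ.x₂ y) i) / poi (k * y) i)

/-- The parameters are optimal: `α`, `u` and the coefficients `κ`, written in two-point form,
minimize the merged objective over all `α ≤ 0`, `u ∈ [0, 1]` and all coefficients. -/
structure IsOptimal (P : ι → ℝ) (k ε : ℝ) (θ : Params) : Prop where
  α_nonpos : θ.α ≤ 0
  u_mem : θ.u ∈ Set.Icc (0 : ℝ) 1
  q_mem : ∀ y ∈ levels P, θ.q y ∈ Set.Ioo (0 : ℝ) 1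
  x₁_nonneg : ∀ y ∈ levels P, 0 ≤ θ.x₁ y
  x₁_lt : ∀ y ∈ levels P, θ.x₁ y < y
  lt_x₂ : ∀ y ∈ levels P, y < θ.x₂ y
  minimal : ∀ α u : ℝ, α ≤ 0 → u ∈ Set.Icc (0 : ℝ) 1 → ∀ κ : ℕ → ℝ → ℝ,
    mergedObjective P k ε θ.α θ.u (θ.kappa k) ≤ mergedObjective P k ε α u κ

/-! ### The conditional coin flip distribution

A realization of the coins is `r : ι → Bool`, with `true` (probability `q_j`) standing for the
outcome `x_{1,j}` and `false` for `x_{2,j}`. A sample is recorded by its histogram `h : ι → ℕ`;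
taking `Poi(k)` samples from a (not necessarily normalized) distribution `p` means that the
counts `h a` are independent Poisson variables of means `k * p a`. -/

/-- The probability of the outcome `b` of the coin of a domain element of hypothesis mass `y`. -/
def Params.coin (θ : Params) (y : ℝ) (b : Bool) : ℝ := if b then θ.q y else 1 - θ.q y

/-- The mass that the outcome `b` assigns to a domain element of hypothesis mass `y`. -/
def Params.mass (θ : Params) (y : ℝ) (b : Bool) : ℝ := if b then θ.x₁ y else θ.x₂ y

/-- The coin realizations whose distribution has `ℓ₁` distance in `[ε, ε']` from `P`. -/
def window (P : ι → ℝ) (θ : Params) (ε ε' : ℝ) : Set (ι → Bool) :=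
  {r | ∑ a, |θ.mass (P a) (r a) - P a| ∈ Set.Icc ε ε'}

/-- `P(h)`: the probability of the histogram `h` under `Poi(k)` samples from `P`. -/
def nullProb (P : ι → ℝ) (k : ℝ) (h : ι → ℕ) : ℝ := ∏ a, poi (k * P a) (h a)

/-- `𝒬(h, r)`: the probability that the coins come out as `r` and that `Poi(k)` samples from the
resulting distribution then have histogram `h`. -/
def jointProb (P : ι → ℝ) (k : ℝ) (θ : Params) (h : ι → ℕ) (r : ι → Bool) : ℝ :=
  ∏ a, θ.coin (P a) (r a) * poi (k * θ.mass (P a) (r a)) (h a)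

open Classical in
/-- `𝒬(h, [ε, ε'])`. -/
def jointWindowProb (P : ι → ℝ) (k : ℝ) (θ : Params) (ε ε' : ℝ) (h : ι → ℕ) : ℝ :=
  ∑ r : ι → Bool, if r ∈ window P θ ε ε' then jointProb P k θ h r else 0

/-- `𝒬([ε, ε'])`. -/
def windowProb (P : ι → ℝ) (k : ℝ) (θ : Params) (ε ε' : ℝ) : ℝ :=
  ∑' h : ι → ℕ, jointWindowProb P k θ ε ε' h

/-- `𝒬_{[ε, ε']}(h)`: the probability of the histogram `h` under the coin flip distribution
conditioned on `ℓ₁` distance in `[ε, ε']` from `P`. -/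
def condProb (P : ι → ℝ) (k : ℝ) (θ : Params) (ε ε' : ℝ) (h : ι → ℕ) : ℝ :=
  jointWindowProb P k θ ε ε' h / windowProb P k θ ε ε'

/-- The failure probability, for distinguishing `P` from `𝒬_{[ε, ε']}` with `Poi(k)` samples, of the
(possibly randomized) tester that says "no" with probability `T h` on the histogram `h`: the
larger of its type 1 and type 2 errors. -/
def failureProb (P : ι → ℝ) (k : ℝ) (θ : Params) (ε ε' : ℝ) (T : (ι → ℕ) → ℝ) : ℝ :=
  max (∑' h : ι → ℕ, nullProb P k h * T h) (∑' h : ι → ℕ, condProb P k θ ε ε' h * (1 - T h))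

/-! ### The Chernoff factors -/

/-- `∑ₕ P(h)^v 𝒬_{[ε, ε']}(h)^(1 - v)`, over the `h` with `𝒬_{[ε, ε']}(h) ≠ 0` (this makes the
expression continuous in `v` up to `v = 1`; the other terms vanish anyway for `v < 1`). -/
def chernoffSum (P : ι → ℝ) (k : ℝ) (θ : Params) (ε ε' v : ℝ) : ℝ :=
  ∑' h : ι → ℕ, if condProb P k θ ε ε' h = 0 then 0
    else nullProb P k h ^ v * condProb P k θ ε ε' h ^ (1 - v)

/-- The log-likelihood ratio of `𝒬_{[ε, ε']}` to `P`. Its junk value `0` where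
`𝒬_{[ε, ε']}(h) = 0` is harmless in `ch₁`. -/
def logRatio (P : ι → ℝ) (k : ℝ) (θ : Params) (ε ε' : ℝ) (h : ι → ℕ) : ℝ :=
  Real.log (condProb P k θ ε ε' h / nullProb P k h)

/-- `ch₁`: the smaller of the probabilities that the log-likelihood ratio is positive under `P`, and
negative under `𝒬_{[ε, ε']}`, divided by their common Chernoff bound. -/
def ch₁ (P : ι → ℝ) (k : ℝ) (θ : Params) (ε ε' : ℝ) : ℝ :=
  min (∑' h : ι → ℕ, {h | 0 < logRatio P k θ ε ε' h}.indicator (nullProb P k) h)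
      (∑' h : ι → ℕ, {h | logRatio P k θ ε ε' h < 0}.indicator (condProb P k θ ε ε') h) /
    ⨅ v : Set.Icc (0 : ℝ) 1, chernoffSum P k θ ε ε' v

/-- `π_{b,j}`: the unnormalized probability of the outcome `b` of the tilted coin of a domain element
of hypothesis mass `y = y_j`. -/
def tilted (k : ℝ) (θ : Params) (v y : ℝ) (b : Bool) : ℝ :=
  ∑' i : ℕ, poi (k * y) i ^ v /
    (θ.q y * poi (k * θ.x₁ y) i + (1 - θ.q y) * poi (k * θ.x₂ y) i) ^ v *
      (θ.coin y b * poi (k * θ.mass y b) i)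

open Classical in
/-- `ch₂`, as a function of the exponent `v`: the unnormalized probability that the tilted coins
`X_j`, with values `|x_{b,j} - y_j|`, have their sum in `[ε, ε']`, divided by its Chernoff bound
(a common normalizing factor of the two is cancelled). -/
def ch₂ (P : ι → ℝ) (k : ℝ) (θ : Params) (ε ε' v : ℝ) : ℝ :=
  (∑ r : ι → Bool, if r ∈ window P θ ε ε' then ∏ a, tilted k θ v (P a) (r a) else 0) /
    ⨅ s : Set.Ici (0 : ℝ), Real.exp (-(s : ℝ) * ε) *
      ∏ a, ∑ b : Bool, Real.exp ((s : ℝ) * |θ.mass (P a) b - P a|) * tilted k θ v (P a) b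

end IdentityTesting

end

open IdentityTesting

open scoped NNReal ENNReal

namespace IdentityTesting

/-! ### Sums of products and Poisson series -/

/-! Write M for the two-point mixture `Params.mix` of a level y, Z_y(v) for the total mass of its
tilted coin, and S_y for the supremum of that level in the merged objective. The two-point form of κ
makes exp(-vκ) the weight (poi(ky, ·)/M)^v, and the mean of exp((1-v)κ) under the hypothesis equal
to Z_y(v). With A = ∑ N_y log Z_y(u) and B = εα + ∑ N_y S_y, the optimal value is G = uA + (1-u)B.

By a Neyman–Pearson argument every test fails with probability at least ch₁ · F(v). Dropping the
window restriction bounds 𝒬(h, [ε, ε']) by the product of the mixtures; as -v ≤ 0, this gives F(v) ≥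
ω^(v-1) · (numerator of ch₂), where ω is the probability of the window. It remains to show that ω ≤
exp(A - B - α(ε'-ε)) and that the denominator of ch₂ is at least exp((1-v)(A-B) + G); the multiples
of A - B then cancel.

Both bounds come from optimality through two variations. Rescaling κ and u with uκ fixed keeps all
the suprema and gives ∑ N_y log Z_y(v) ≥ (1-v)(A-B) + G for every v
(`IsSupValue.le_sum_log_tilted`). Lowering α while changing the coefficients shows that x₁ and x₂
both attain the supremum and that the tilted coins at u have total mean distance at least ε
(`IsSupValue.attained`). Attainment turns a Markov bound on ω into the required one. The mean bound,
joined to the first variation by convexity of the log moment generating function in (v, s), gives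
the bound on the denominator (`IsSupValue.le_log_tiltedMgf`).

The second variation must respect a constraint at every x ≥ 0. Poisson means of finitely supported
coefficients are exp(-kx) times arbitrary polynomials, so a prescribed continuous direction can be
followed on a bounded interval, up to a small error and exactly at x₁ and x₂; geometric damping
controls large x (`GeomComparable.exists_perturbation`). The variations need 0 < u < 1: an explicit
choice has G < 0, while G ≥ 0 at u = 0 and u = 1. Finally Δ ≤ G, since adding a constant to the
coefficients balances the two Chernoff bounds. -/

theorem hasSum_mul_of_nonneg {α β : Type*} {f : α → ℝ} {g : β → ℝ} {s t : ℝ}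
    (hf : HasSum f s) (hg : HasSum g t) (hf0 : ∀ x, 0 ≤ f x) (hg0 : ∀ y, 0 ≤ g y) :
    HasSum (fun x : α × β => f x.1 * g x.2) (s * t) :=
  hf.mul hg (hf.summable.mul_of_nonneg hg.summable hf0 hg0)

theorem hasSum_fin_prod (n : ℕ) (g : Fin n → ℕ → ℝ) (h0 : ∀ a i, 0 ≤ g a i)
    (hs : ∀ a, Summable (g a)) :
    HasSum (fun h : Fin n → ℕ => ∏ a, g a (h a)) (∏ a, ∑' i, g a i) := by
  induction n with
  | zero => simp
  | succ n ih =>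
    have ih := ih (fun a => g a.succ) (fun a => h0 a.succ) (fun a => hs a.succ)
    have h1 := (hs 0).hasSum
    have h2 := hasSum_mul_of_nonneg h1 ih (h0 0) fun h => Finset.prod_nonneg fun a _ => h0 _ _
    rw [Fin.prod_univ_succ, ← (Fin.consEquiv fun _ : Fin (n + 1) => ℕ).hasSum_iff]
    refine h2.congr_fun ?_
    rintro ⟨x, h⟩
    simp [Fin.prod_univ_succ, Fin.consEquiv]

theorem hasSum_pi_prod {ι : Type*} [Fintype ι] (g : ι → ℕ → ℝ) (h0 : ∀ a i, 0 ≤ g a i)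
    (hs : ∀ a, Summable (g a)) :
    HasSum (fun h : ι → ℕ => ∏ a, g a (h a)) (∏ a, ∑' i, g a i) := by
  let e := (Fintype.equivFin ι).symm
  have h1 := hasSum_fin_prod _ (fun a => g (e a)) (fun a => h0 (e a)) (fun a => hs (e a))
  rw [e.prod_comp (fun a => ∑' i, g a i)] at h1
  rw [← (e.arrowCongr (Equiv.refl ℕ)).hasSum_iff]
  refine h1.congr_fun fun h => ?_
  simp only [Function.comp]
  rw [← e.prod_comp]
  simp

theorem poi_nonneg {r : ℝ} (hr : 0 ≤ r) (i : ℕ) : 0 ≤ poi r i := by unfold poi; positivity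

theorem poi_pos {r : ℝ} (hr : 0 < r) (i : ℕ) : 0 < poi r i := by unfold poi; positivity

theorem poi_zero_right (r : ℝ) : poi r 0 = Real.exp (-r) := by simp [poi]

theorem hasSum_pow_mul_poi (z r : ℝ) :
    HasSum (fun i => z ^ i * poi r i) (Real.exp (-(r * (1 - z)))) := by
  have h := (NormedSpace.expSeries_div_hasSum_exp (z * r)).mul_left (Real.exp (-r))
  rw [← Real.exp_eq_exp_ℝ, ← Real.exp_add, show -r + z * r = -(r * (1 - z)) by ring] at h
  refine h.congr_fun fun i => ?_
  simp only [poi, mul_pow]; ring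

theorem hasSum_poi (r : ℝ) : HasSum (poi r) 1 := by simpa using hasSum_pow_mul_poi 1 r

/-- The exponential growth condition under which a series can be integrated against a Poisson
distribution. -/
def ExpGrowth (f : ℕ → ℝ) : Prop := ∃ K D : ℝ, 0 ≤ K ∧ 0 ≤ D ∧ ∀ i, |f i| ≤ K * D ^ i

theorem ExpGrowth.mul {f g : ℕ → ℝ} (hf : ExpGrowth f) (hg : ExpGrowth g) :
    ExpGrowth (fun i => f i * g i) := by
  obtain ⟨K, D, hK, hD, h⟩ := hf
  obtain ⟨K', D', hK', hD', h'⟩ := hg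
  refine ⟨K * K', D * D', by positivity, by positivity, fun i => ?_⟩
  rw [abs_mul, mul_pow, mul_mul_mul_comm]
  exact mul_le_mul (h i) (h' i) (abs_nonneg _) (by positivity)

theorem ExpGrowth.add {f g : ℕ → ℝ} (hf : ExpGrowth f) (hg : ExpGrowth g) :
    ExpGrowth (fun i => f i + g i) := by
  obtain ⟨K, D, hK, hD, h⟩ := hf
  obtain ⟨K', D', hK', hD', h'⟩ := hg
  refine ⟨K + K', D + D', by positivity, by positivity, fun i => ?_⟩
  have h1 : D ^ i ≤ (D + D') ^ i := by gcongr; linarith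
  have h2 : D' ^ i ≤ (D + D') ^ i := by gcongr; linarith
  calc |f i + g i| ≤ |f i| + |g i| := abs_add_le _ _
    _ ≤ K * D ^ i + K' * D' ^ i := add_le_add (h i) (h' i)
    _ ≤ K * (D + D') ^ i + K' * (D + D') ^ i := by gcongr
    _ = _ := by ring

theorem ExpGrowth.of_abs_le {f g : ℕ → ℝ} (hg : ExpGrowth g) (h : ∀ i, |f i| ≤ g i) :
    ExpGrowth f := by
  obtain ⟨K, D, hK, hD, h'⟩ := hg
  exact ⟨K, D, hK, hD, fun i => (h i).trans ((le_abs_self _).trans (h' i))⟩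

theorem ExpGrowth.const_mul_pow (K D : ℝ) : ExpGrowth (fun i => K * D ^ i) :=
  ⟨|K|, |D|, abs_nonneg _, abs_nonneg _, fun i => by rw [abs_mul, abs_pow]⟩

theorem ExpGrowth.const (K : ℝ) : ExpGrowth (fun _ => K) := by
  simpa using ExpGrowth.const_mul_pow K 1

theorem ExpGrowth.natCast : ExpGrowth (fun i => (i : ℝ)) :=
  ⟨1, 2, by norm_num, by norm_num, fun i => by
    rw [Nat.abs_cast, one_mul]; exact_mod_cast Nat.lt_two_pow_self.le⟩

theorem ExpGrowth.exp {f : ℕ → ℝ} {K D : ℝ} (h : ∀ i, f i ≤ K + D * i) :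
    ExpGrowth (fun i => Real.exp (f i)) :=
  ⟨Real.exp K, Real.exp D, by positivity, by positivity, fun i => by
    rw [abs_of_pos (Real.exp_pos _), ← Real.exp_nat_mul, ← Real.exp_add, Real.exp_le_exp]
    linarith [h i]⟩

theorem ExpGrowth.summable {f : ℕ → ℝ} (hf : ExpGrowth f) (r : ℝ) :
    Summable (fun i => f i * poi r i) := by
  obtain ⟨K, D, hK, hD, h⟩ := hf
  refine Summable.of_norm_bounded
    (((hasSum_pow_mul_poi D |r|).summable.mul_left K).mul_left (Real.exp (|r| - r))) fun i => ?_
  have h1 : Real.exp (|r| - r) * poi |r| i = |poi r i| := by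
    rw [poi, poi, abs_div, abs_mul, abs_pow, Nat.abs_cast, abs_of_pos (Real.exp_pos _),
      ← mul_div_assoc, ← mul_assoc, ← Real.exp_add]
    ring_nf
  rw [Real.norm_eq_abs, abs_mul, ← h1]
  calc |f i| * (Real.exp (|r| - r) * poi |r| i)
      ≤ (K * D ^ i) * (Real.exp (|r| - r) * poi |r| i) :=
        mul_le_mul_of_nonneg_right (h i)
          (mul_nonneg (Real.exp_pos _).le (poi_nonneg (abs_nonneg _) _))
    _ = _ := by ring

theorem ExpGrowth.summable_mul_pow_div {f : ℕ → ℝ} (hf : ExpGrowth f) (r : ℝ) :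
    Summable (fun i => f i * (r ^ i / (i.factorial : ℝ))) := by
  refine ((hf.summable r).mul_left (Real.exp r)).congr fun i => ?_
  rw [poi, mul_left_comm, mul_div_assoc, ← mul_assoc (Real.exp r), ← Real.exp_add]
  simp

theorem ExpGrowth.continuousOn_tsum {f : ℕ → ℝ} (hf : ExpGrowth f) {k : ℝ} (hk : 0 ≤ k) (R : ℝ) :
    ContinuousOn (fun x => ∑' i, f i * poi (k * x) i) (Set.Icc 0 R) := by
  have h2 : ExpGrowth (fun i => |f i|) := by
    obtain ⟨K, D, hK, hD, h⟩ := hf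
    exact ⟨K, D, hK, hD, fun i => by rw [abs_abs]; exact h i⟩
  refine _root_.continuousOn_tsum (u := fun i => |f i| * ((k * R) ^ i / (i.factorial : ℝ)))
    (fun i => ?_) (h2.summable_mul_pow_div (k * R)) fun i x hx => ?_
  · unfold poi; fun_prop
  · have hx0 : 0 ≤ k * x := mul_nonneg hk hx.1
    rw [Real.norm_eq_abs, abs_mul, abs_of_nonneg (poi_nonneg hx0 _)]
    refine mul_le_mul_of_nonneg_left ?_ (abs_nonneg _)
    unfold poi
    gcongr
    calc Real.exp (-(k * x)) * (k * x) ^ i ≤ 1 * (k * x) ^ i := by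
          gcongr; exact Real.exp_le_one_iff.2 (by linarith)
      _ ≤ (k * R) ^ i := by rw [one_mul]; have := hx.2; gcongr

/-! ### Elementary inequalities for the exponential. -/

theorem exp_le_one_add_add_sq (t : ℝ) : Real.exp t ≤ 1 + t + t ^ 2 * Real.exp |t| := by
  have h1 : Real.exp t - 1 ≤ t * Real.exp t := by
    have := Real.add_one_le_exp (-t)
    have h2 : Real.exp t * Real.exp (-t) = 1 := by rw [← Real.exp_add]; simp
    nlinarith [Real.exp_pos t]
  rcases le_total 0 t with ht | ht
  · rw [abs_of_nonneg ht]; nlinarith [Real.exp_pos t]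
  · have h3 := Real.one_le_exp (abs_nonneg t)
    have h4 := Real.add_one_le_exp t
    nlinarith [sq_nonneg t]

theorem exp_neg_le_one_sub_add_sq {t : ℝ} (ht : 0 ≤ t) : Real.exp (-t) ≤ 1 - t + t ^ 2 := by
  have h1 := Real.add_one_le_exp t
  have h2 : Real.exp t * Real.exp (-t) = 1 := by rw [← Real.exp_add]; simp
  have h3 : 0 < Real.exp (-t) := Real.exp_pos _
  have h4 : Real.exp (-t) * (t + 1) ≤ 1 := by nlinarith
  have h5 : 1 ≤ (1 - t + t ^ 2) * (t + 1) := by nlinarith [pow_nonneg ht 3]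
  have h6 : 0 < t + 1 := by linarith
  exact le_of_mul_le_mul_right (h4.trans h5) h6

theorem exp_neg_sub_le_one_sub {t : ℝ} (ht : |t| ≤ 1 / 2) :
    Real.exp (-t - 2 * t ^ 2) ≤ 1 - t := by
  obtain ⟨h1, h2⟩ := abs_le.1 ht
  have h3 : 0 < 1 - t := by linarith
  rw [← Real.le_log_iff_exp_le h3]
  refine le_trans ?_ (Real.one_sub_inv_le_log_of_pos h3)
  rw [show 1 - (1 - t)⁻¹ = -t / (1 - t) by field_simp; ring, le_div_iff₀ h3]
  nlinarith [sq_nonneg t]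

/-- The convex function exp(-t) - 1 + t has slopes 1 - exp(-b) at b and -(exp b - 1) at -b, the
latter at least as steep. Outside [-b, b] it therefore lies above lines of slope ±c through ±b. -/
theorem linear_le_exp_neg_sub {b c : ℝ} (hc : 0 ≤ c) (hcb : c ≤ 1 - Real.exp (-b))
    (t : ℝ) : c * (|t| - b) ≤ Real.exp (-t) - 1 + t := by
  have h0 : 0 ≤ Real.exp (-t) - 1 + t := by linarith [Real.add_one_le_exp (-t)]
  rcases le_total |t| b with htb | htb
  · exact (mul_nonpos_of_nonneg_of_nonpos hc (by linarith)).trans h0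
  refine (mul_le_mul_of_nonneg_right hcb (by linarith)).trans ?_
  have e1 : 0 < Real.exp (-b) := Real.exp_pos _
  have e2 : Real.exp b * Real.exp (-b) = 1 := by rw [← Real.exp_add]; simp
  have hb1 := Real.add_one_le_exp (-b)
  have hb2 := Real.add_one_le_exp b
  rcases le_total 0 t with ht | ht
  · rw [abs_of_nonneg ht] at *
    have h1 : Real.exp (-t) = Real.exp (-b) * Real.exp (-(t - b)) := by
      rw [← Real.exp_add]; ring_nf
    have h2 := Real.add_one_le_exp (-(t - b))
    nlinarith
  · rw [abs_of_nonpos ht] at *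
    have h1 : Real.exp (-t) = Real.exp b * Real.exp (-(t + b)) := by
      rw [← Real.exp_add]; ring_nf
    have h2 := Real.add_one_le_exp (-(t + b))
    have h3 : 1 - Real.exp (-b) ≤ Real.exp b - 1 := by nlinarith
    have h4 : (1 - Real.exp (-b)) * (-t - b) ≤ (Real.exp b - 1) * (-t - b) :=
      mul_le_mul_of_nonneg_right h3 (by linarith)
    nlinarith [Real.exp_pos b]

/-! ### Perturbing the weights of one level -/

/-- The polynomial is the linear interpolant of Φ at the two nodes plus a large multiple of (x -
x₁)²(x - x₂)². The extra term preserves the nodal values and, being quartic, beats the linear part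
beyond R. -/
theorem exists_polynomial_majorant {Φ : ℝ → ℝ} {R x₁ x₂ η : ℝ}
    (hΦ : ContinuousOn Φ (Set.Icc 0 R)) (h12 : x₁ < x₂) (h2R : x₂ < R) (hη : 0 < η) :
    ∃ p : Polynomial ℝ, (∀ x ∈ Set.Icc 0 R, Φ x - η ≤ p.eval x) ∧ p.eval x₁ = Φ x₁ ∧
      p.eval x₂ = Φ x₂ ∧ ∀ x, R ≤ x → 0 ≤ p.eval x := by
  have hd : x₂ - x₁ ≠ 0 := by linarith
  set m := (Φ x₂ - Φ x₁) / (x₂ - x₁) with hm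
  set l : ℝ → ℝ := fun x => Φ x₁ + m * (x - x₁) with hl
  set b : ℝ → ℝ := fun x => (x - x₁) ^ 2 * (x - x₂) ^ 2 with hb
  have hl2 : l x₂ = Φ x₂ := by simp only [hl, hm]; field_simp; ring
  have hb0 : ∀ x, 0 ≤ b x := fun x => by simp only [hb]; positivity
  have hlc : Continuous l := by simp only [hl]; fun_prop
  have hbc : Continuous b := by simp only [hb]; fun_prop
  obtain ⟨K₁, hK₁⟩ : ∃ K₁ : ℝ, ∀ x ∈ Set.Icc 0 R, Φ x - l x - η ≤ |K₁| * b x := by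
    -- The set where the interpolant falls short by at least η is compact and misses both nodes, so
    -- the shortfall divided by b is bounded on it.
    set s := Set.Icc 0 R ∩ {x | η ≤ Φ x - l x} with hs
    have hcl : IsClosed s :=
      (hΦ.sub hlc.continuousOn).preimage_isClosed_of_isClosed isClosed_Icc isClosed_Ici
    have hcs : IsCompact s := isCompact_Icc.of_isClosed_subset hcl Set.inter_subset_left
    have hbs : ∀ x ∈ s, b x ≠ 0 := by
      rintro x ⟨-, hx⟩ h0
      rcases mul_eq_zero.1 h0 with h | h
      · have hxx : x = x₁ := by nlinarith [pow_eq_zero_iff (two_ne_zero) |>.1 h]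
        subst hxx; simp [hl] at hx; linarith
      · have hxx : x = x₂ := by nlinarith [pow_eq_zero_iff (two_ne_zero) |>.1 h]
        subst hxx; simp only [Set.mem_ofPred_eq, hl2] at hx; linarith
    obtain ⟨K, hK⟩ := hcs.exists_bound_of_continuousOn (f := fun x => (Φ x - l x - η) / b x)
      ((((hΦ.mono Set.inter_subset_left).sub hlc.continuousOn).sub continuousOn_const).div
        hbc.continuousOn hbs)
    refine ⟨K, fun x hx => ?_⟩
    by_cases hxs : x ∈ s
    · have h1 := (le_abs_self _).trans ((hK x hxs).trans (le_abs_self K))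
      have h2 : 0 < b x := lt_of_le_of_ne (hb0 x) (hbs x hxs).symm
      rwa [div_le_iff₀ h2] at h1
    · have h1 : ¬ η ≤ Φ x - l x := fun h => hxs ⟨hx, h⟩
      have := mul_nonneg (abs_nonneg K) (hb0 x)
      linarith
  set d := R - x₂ with hdd
  have hd0 : 0 < d := by linarith
  -- Beyond R one has b ≥ d⁴ and b ≥ d³(x - R); the two summands pay for |l R| and for |m|(x - R).
  set K₂ := |l R| / d ^ 4 + |m| / d ^ 3
  set K := |K₁| + K₂ with hK
  have hK₂ : 0 ≤ K₂ := by positivity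
  refine ⟨Polynomial.C (Φ x₁) + Polynomial.C m * (Polynomial.X - Polynomial.C x₁) +
    Polynomial.C K * ((Polynomial.X - Polynomial.C x₁) ^ 2 *
      (Polynomial.X - Polynomial.C x₂) ^ 2), ?_⟩
  have he : ∀ x, (Polynomial.C (Φ x₁) + Polynomial.C m * (Polynomial.X - Polynomial.C x₁) +
    Polynomial.C K * ((Polynomial.X - Polynomial.C x₁) ^ 2 *
      (Polynomial.X - Polynomial.C x₂) ^ 2)).eval x = l x + K * b x := fun x => by
    simp [hl, hb]
  simp only [he]
  refine ⟨fun x hx => ?_, by simp [hl, hb], by simp [hl2, hb], fun x hx => ?_⟩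
  · have := hK₁ x hx
    have h2 : |K₁| * b x ≤ K * b x := mul_le_mul_of_nonneg_right (by linarith) (hb0 x)
    linarith
  · have h1 : d ≤ x - x₂ := by linarith
    have h2 : d ≤ x - x₁ := by linarith
    have h3 : l x = l R + m * (x - R) := by simp only [hl]; ring
    have h4 : d ^ 3 * (d + (x - R)) ≤ b x := by
      have h5 : d + (x - R) = x - x₂ := by simp only [hdd]; ring
      rw [h5]
      calc d ^ 3 * (x - x₂) = d ^ 2 * (d * (x - x₂)) := by ring
        _ ≤ (x - x₁) ^ 2 * ((x - x₂) * (x - x₂)) := by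
          have h50 : 0 ≤ x - x₂ := by linarith
          gcongr
        _ = b x := by simp only [hb]; ring
    have h6 : |l R| + |m| * (x - R) ≤ K₂ * b x := by
      have e1 : |l R| ≤ |l R| / d ^ 4 * b x := by
        rw [div_mul_eq_mul_div, le_div_iff₀ (by positivity)]
        refine mul_le_mul_of_nonneg_left ?_ (abs_nonneg _)
        nlinarith [mul_nonneg (pow_nonneg hd0.le 3) (sub_nonneg.2 hx)]
      have e2 : |m| * (x - R) ≤ |m| / d ^ 3 * b x := by
        rw [div_mul_eq_mul_div, le_div_iff₀ (by positivity), mul_assoc]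
        refine mul_le_mul_of_nonneg_left ?_ (abs_nonneg _)
        nlinarith [pow_nonneg hd0.le 4]
      calc _ ≤ |l R| / d ^ 4 * b x + |m| / d ^ 3 * b x := add_le_add e1 e2
        _ = _ := by ring
    have h7 := mul_nonneg (abs_nonneg K₁) (hb0 x)
    have h8 : -(|m| * (x - R)) ≤ m * (x - R) := by
      rw [← neg_mul]; exact mul_le_mul_of_nonneg_right (neg_abs_le m) (by linarith)
    have h9 := neg_abs_le (l R)
    rw [hK, add_mul]
    linarith

/-- The expectation of `f` under the Poisson distribution of mean `k * x`. -/
noncomputable def poissonMean (k : ℝ) (f : ℕ → ℝ) (x : ℝ) : ℝ := ∑' i, f i * poi (k * x) i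

/-- The weights are comparable to a geometric sequence. -/
structure GeomComparable (w : ℕ → ℝ) (ζ c₁ c₂ : ℝ) : Prop where
  ratio_pos : 0 < ζ
  lower_pos : 0 < c₁
  lower : ∀ i, c₁ * ζ ^ i ≤ w i
  upper : ∀ i, w i ≤ c₂ * ζ ^ i

namespace GeomComparable

theorem pos {w : ℕ → ℝ} {ζ c₁ c₂ : ℝ} (H : GeomComparable w ζ c₁ c₂) (i : ℕ) : 0 < w i :=
  (mul_pos H.lower_pos (pow_pos H.ratio_pos i)).trans_le (H.lower i)

theorem expGrowth {w : ℕ → ℝ} {ζ c₁ c₂ : ℝ} (H : GeomComparable w ζ c₁ c₂) : ExpGrowth w :=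
  (ExpGrowth.const_mul_pow c₂ ζ).of_abs_le fun i => by rw [abs_of_pos (H.pos i)]; exact H.upper i

theorem le_poissonMean {w : ℕ → ℝ} {ζ c₁ c₂ : ℝ} (H : GeomComparable w ζ c₁ c₂) {k x : ℝ}
    (hx : 0 ≤ k * x) : c₁ * Real.exp (-(k * x)) ≤ poissonMean k w x := by
  have h1 := (H.expGrowth.summable (k * x)).le_tsum 0
    (fun i _ => mul_nonneg (H.pos i).le (poi_nonneg hx i))
  rw [poi_zero_right] at h1
  refine le_trans ?_ h1
  have := H.lower 0
  simp only [pow_zero, mul_one] at this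
  gcongr

theorem poissonMean_pos {w : ℕ → ℝ} {ζ c₁ c₂ : ℝ} (H : GeomComparable w ζ c₁ c₂) {k x : ℝ}
    (hx : 0 ≤ k * x) : 0 < poissonMean k w x :=
  (mul_pos H.lower_pos (Real.exp_pos _)).trans_le (H.le_poissonMean hx)

/-- Damping by exp(-i) multiplies a Poisson mean of ratio ζ by exp(-kζx(1 - 1/e)), at most exp(-2tx)
for t = kζ/4. Half of this gain absorbs c₂/c₁ once x is large, which settles τ = t. Smaller τ follow
by convexity of the exponential. -/
theorem exists_tail_bound {w : ℕ → ℝ} {ζ c₁ c₂ : ℝ} (H : GeomComparable w ζ c₁ c₂) {k : ℝ}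
    (hk : 0 < k) :
    ∃ C R τ₀ : ℝ, 0 ≤ C ∧ 0 < τ₀ ∧ ∀ x, 0 ≤ x → R ≤ x → ∀ τ, 0 ≤ τ → τ ≤ τ₀ →
      poissonMean k (fun i => w i * Real.exp (-(τ * (C * i)))) x ≤
        Real.exp (-(τ * x)) * poissonMean k w x := by
  have hζ := H.ratio_pos
  have hc₁ := H.lower_pos
  have hc₂ : 0 < c₂ := by
    have h1 := H.lower 0; have h2 := H.upper 0
    simp only [pow_zero, mul_one] at h1 h2; linarith
  set t := k * ζ / 4 with ht
  have ht0 : 0 < t := by positivity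
  -- C = 1/t turns the damping at τ = t into exp(-i), and R = (c₂/c₁)/t ensures c₂/c₁ ≤ tx ≤
  -- exp(tx).
  refine ⟨1 / t, 4 * (c₂ / c₁) / (k * ζ), t, by positivity, ht0, fun x hx hR τ hτ hτt => ?_⟩
  have hkx : 0 ≤ k * x := by positivity
  set z := Real.exp (-1) with hz
  have hz0 : 0 < z := Real.exp_pos _
  have hz1 : z ≤ 1 / 2 := by
    have h1 := Real.add_one_le_exp (1 : ℝ)
    have h2 : z * Real.exp 1 = 1 := by rw [hz, ← Real.exp_add]; simp
    nlinarith
  have hwz : ExpGrowth (fun i => w i * z ^ i) := by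
    have := H.expGrowth.mul (ExpGrowth.const_mul_pow 1 z); simpa using this
  have hbase : poissonMean k (fun i => w i * z ^ i) x ≤
      Real.exp (-(t * x)) * poissonMean k w x := by
    have h1 : poissonMean k (fun i => w i * z ^ i) x ≤
        c₂ * Real.exp (-(k * x * (1 - ζ * z))) := by
      refine hasSum_le (fun i => ?_) (hwz.summable _).hasSum
        ((hasSum_pow_mul_poi (ζ * z) (k * x)).mul_left c₂)
      have := H.upper i
      rw [mul_pow, ← mul_assoc, ← mul_assoc]
      have := poi_nonneg hkx i
      gcongr
    have h2 : c₁ * Real.exp (-(k * x * (1 - ζ))) ≤ poissonMean k w x := by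
      refine hasSum_le (fun i => ?_) ((hasSum_pow_mul_poi ζ (k * x)).mul_left c₁)
        (H.expGrowth.summable _).hasSum
      rw [← mul_assoc]
      exact mul_le_mul_of_nonneg_right (H.lower i) (poi_nonneg hkx i)
    have h3 : c₂ / c₁ ≤ Real.exp (t * x) := by
      have e1 : c₂ / c₁ ≤ t * x := by
        rw [div_le_iff₀ (by positivity)] at hR
        rw [ht]; linarith
      linarith [Real.add_one_le_exp (t * x)]
    rw [div_le_iff₀ hc₁] at h3
    calc poissonMean k (fun i => w i * z ^ i) x ≤ _ := h1
      _ ≤ Real.exp (t * x) * c₁ * Real.exp (-(k * x * (1 - ζ * z))) := by gcongr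
      _ = c₁ * Real.exp (t * x + -(k * x * (1 - ζ * z))) := by rw [Real.exp_add]; ring
      _ ≤ c₁ * Real.exp (-(t * x) + -(k * x * (1 - ζ))) := by
        refine mul_le_mul_of_nonneg_left (Real.exp_le_exp.2 ?_) hc₁.le
        have : 0 ≤ k * x * ζ * (1 / 2 - z) := mul_nonneg (by positivity) (by linarith)
        rw [ht]; linarith
      _ = Real.exp (-(t * x)) * (c₁ * Real.exp (-(k * x * (1 - ζ)))) := by
        rw [Real.exp_add]; ring
      _ ≤ _ := by gcongr
  -- Interpolation between no damping (l = 0) and the full damping z^i (l = 1), by weighted AM-GM.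
  set l := τ / t with hl
  have hl0 : 0 ≤ l := by positivity
  have hl1 : l ≤ 1 := (div_le_one ht0).2 hτt
  have hlt : l * t = τ := by rw [hl]; field_simp
  have hpt : ∀ i : ℕ, w i * Real.exp (-(τ * (1 / t * i))) ≤
      Real.exp (-(τ * x)) * ((1 - l) * w i + l * Real.exp (t * x) * (w i * z ^ i)) := fun i => by
    have h2 := Real.geom_mean_le_arith_mean2_weighted (sub_nonneg.2 hl1) hl0 zero_le_one
      (Real.exp_pos (t * x - i)).le (by ring)
    rw [Real.one_rpow, one_mul, ← Real.exp_mul, mul_one] at h2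
    have h3 : Real.exp (-(τ * (1 / t * i))) =
        Real.exp (-(τ * x)) * Real.exp ((t * x - i) * l) := by
      rw [← Real.exp_add, hl]; congr 1; field_simp; ring
    have h4 : z ^ i = Real.exp (-i) := by rw [hz, ← Real.exp_nat_mul]; ring_nf
    rw [h3, h4, mul_left_comm]
    refine mul_le_mul_of_nonneg_left ?_ (Real.exp_pos _).le
    calc w i * Real.exp ((t * x - i) * l) ≤ w i * (1 - l + l * Real.exp (t * x - i)) :=
          mul_le_mul_of_nonneg_left h2 (H.pos i).le
      _ = _ := by rw [sub_eq_add_neg (t * x), Real.exp_add]; ring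
  have hsum := (((H.expGrowth.summable (k * x)).hasSum.mul_left (1 - l)).add
    ((hwz.summable (k * x)).hasSum.mul_left (l * Real.exp (t * x)))).mul_left (Real.exp (-(τ * x)))
  have hE : ExpGrowth (fun i : ℕ => w i * Real.exp (-(τ * (1 / t * i)))) :=
    H.expGrowth.mul (ExpGrowth.exp (K := 0) (D := 0) fun i => by
      have : 0 ≤ τ * (1 / t * i) := by positivity
      linarith)
  refine (hasSum_le (fun i => ?_) (hE.summable (k * x)).hasSum hsum).trans ?_
  · calc _ ≤ _ := mul_le_mul_of_nonneg_right (hpt i) (poi_nonneg hkx i)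
      _ = _ := by ring
  · refine mul_le_mul_of_nonneg_left ?_ (Real.exp_pos _).le
    have h5 : l * Real.exp (t * x) * poissonMean k (fun i => w i * z ^ i) x ≤
        l * Real.exp (t * x) * (Real.exp (-(t * x)) * poissonMean k w x) := by gcongr
    have h6 : Real.exp (t * x) * Real.exp (-(t * x)) = 1 := by rw [← Real.exp_add]; simp
    have h7 : l * Real.exp (t * x) * (Real.exp (-(t * x)) * poissonMean k w x) =
        l * poissonMean k w x := by linear_combination l * poissonMean k w x * h6
    simp only [poissonMean] at h5 h7 ⊢
    linarith

end GeomComparable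

/-! ### Perturbing the weights in polynomial directions. -/

theorem ExpGrowth.mul_natCast {f : ℕ → ℝ} (hf : ExpGrowth f) : ExpGrowth (fun i => f i * i) :=
  hf.mul ExpGrowth.natCast

/-- The finitely supported coefficients whose Poisson mean is a polynomial times `exp (-k x)`. -/
noncomputable def polyCoeff (k : ℝ) (p : Polynomial ℝ) (i : ℕ) : ℝ :=
  p.coeff i * (i.factorial : ℝ) / k ^ i

theorem polyCoeff_eq_zero {k : ℝ} {p : Polynomial ℝ} {i : ℕ} (h : p.natDegree + 1 ≤ i) :
    polyCoeff k p i = 0 := by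
  rw [polyCoeff, Polynomial.coeff_eq_zero_of_natDegree_lt (by omega)]; simp

theorem hasSum_polyCoeff {k : ℝ} (hk : 0 < k) (p : Polynomial ℝ) (x : ℝ) :
    HasSum (fun i => polyCoeff k p i * poi (k * x) i) (Real.exp (-(k * x)) * p.eval x) := by
  have h : HasSum (fun i => polyCoeff k p i * poi (k * x) i)
      (∑ i ∈ Finset.range (p.natDegree + 1), polyCoeff k p i * poi (k * x) i) := by
    refine hasSum_sum_of_ne_finset_zero fun i hi => ?_
    rw [polyCoeff_eq_zero (by simpa using hi), zero_mul]
  convert h using 1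
  rw [Polynomial.eval_eq_sum_range, Finset.mul_sum]
  refine Finset.sum_congr rfl fun i _ => ?_
  rw [polyCoeff, poi, mul_pow]
  have := i.factorial_ne_zero
  field_simp

/-- The distance to `y`, penalized by `L` times the slack in the constraint that
`log (poissonMean k w x) + s |x - y|` is at most `S`. -/
noncomputable def slackTarget (k y s S L : ℝ) (w : ℕ → ℝ) (x : ℝ) : ℝ :=
  |x - y| - L * (S - s * |x - y| - Real.log (poissonMean k w x))

/-- Weights perturbed by `τ` in the direction given by a geometric decay and a polynomial. -/
noncomputable def perturbed (k : ℝ) (w : ℕ → ℝ) (C : ℝ) (p : Polynomial ℝ)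
    (τ : ℝ) (i : ℕ) : ℝ :=
  w i * Real.exp (-(τ * (C * i))) - τ * polyCoeff k p i

namespace GeomComparable

/-- To first order in τ the perturbation lowers the Poisson mean by the expression bounded here,
which should be the mean times the target. After division by exp(-kx) this becomes a polynomial
majorant problem; equality at x₁ and x₂ is what the moment of the mixture will see. -/
theorem exists_direction {w : ℕ → ℝ} {ζ c₁ c₂ : ℝ} (H : GeomComparable w ζ c₁ c₂) {k : ℝ}
    (hk : 0 < k) {y s S L η x₁ x₂ : ℝ} (h₁ : 0 ≤ x₁) (h₁₂ : x₁ < x₂) (hη : 0 < η) :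
    ∃ (C R τ₀ : ℝ) (p : Polynomial ℝ), 0 ≤ C ∧ y ≤ R ∧ 0 < τ₀ ∧
      (∀ x, 0 ≤ x → R ≤ x → ∀ τ, 0 ≤ τ → τ ≤ τ₀ →
        poissonMean k (fun i => w i * Real.exp (-(τ * (C * i)))) x ≤
          Real.exp (-(τ * x)) * poissonMean k w x) ∧
      (∀ x, R ≤ x → 0 ≤ p.eval x) ∧
      (∀ x ∈ Set.Icc 0 R, poissonMean k w x * (slackTarget k y s S L w x - η) ≤
        C * poissonMean k (fun i => w i * i) x + Real.exp (-(k * x)) * p.eval x) ∧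
      (∀ x, x = x₁ ∨ x = x₂ → C * poissonMean k (fun i => w i * i) x +
        Real.exp (-(k * x)) * p.eval x = poissonMean k w x * slackTarget k y s S L w x) := by
  obtain ⟨C, R₀, τ₀, hC, hτ₀, htail⟩ := H.exists_tail_bound hk
  set R := max (max R₀ y) (x₂ + 1) with hR
  set Φ : ℝ → ℝ := fun x => Real.exp (k * x) * (poissonMean k w x * slackTarget k y s S L w x -
    C * poissonMean k (fun i => w i * i) x) with hΦ
  have hW : ContinuousOn (poissonMean k w) (Set.Icc 0 R) := H.expGrowth.continuousOn_tsum hk.le R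
  have hI : ContinuousOn (poissonMean k (fun i => w i * i)) (Set.Icc 0 R) :=
    H.expGrowth.mul_natCast.continuousOn_tsum hk.le R
  have hlog : ContinuousOn (fun x => Real.log (poissonMean k w x)) (Set.Icc 0 R) :=
    hW.log fun x hx => (H.poissonMean_pos (mul_nonneg hk.le hx.1)).ne'
  have hΦc : ContinuousOn Φ (Set.Icc 0 R) := by
    simp only [hΦ, slackTarget]
    fun_prop
  have hc₁ := H.lower_pos
  -- The tolerance c₁η becomes c₁ exp(-kx) η after multiplication by exp(-kx), hence at most η times
  -- the mean of w.
  obtain ⟨p, hp1, hp2, hp3, hp4⟩ := exists_polynomial_majorant (x₁ := x₁) (x₂ := x₂)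
    (η := c₁ * η) hΦc h₁₂ (by rw [hR]; exact lt_max_of_lt_right (by linarith)) (by positivity)
  have hee : ∀ x, Real.exp (-(k * x)) * Real.exp (k * x) = 1 := fun x => by
    rw [← Real.exp_add]; simp
  refine ⟨C, R, τ₀, p, hC, (le_max_right _ _).trans (le_max_left _ _), hτ₀, fun x hx hRx =>
    htail x hx (((le_max_left _ _).trans (le_max_left _ _)).trans hRx), hp4, fun x hx => ?_, ?_⟩
  · have h2 := mul_le_mul_of_nonneg_left (hp1 x hx) (Real.exp_pos (-(k * x))).le
    have h3 := mul_le_mul_of_nonneg_right (H.le_poissonMean (mul_nonneg hk.le hx.1)) hη.le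
    have h4 : Real.exp (-(k * x)) * (Φ x - c₁ * η) = poissonMean k w x * slackTarget k y s S L w x -
        C * poissonMean k (fun i => w i * i) x - c₁ * Real.exp (-(k * x)) * η := by
      simp only [hΦ]; linear_combination (poissonMean k w x * slackTarget k y s S L w x -
        C * poissonMean k (fun i => w i * i) x) * hee x
    linarith
  · have h5 : ∀ x, p.eval x = Φ x → C * poissonMean k (fun i => w i * i) x +
        Real.exp (-(k * x)) * p.eval x = poissonMean k w x * slackTarget k y s S L w x := by
      intro x hx
      rw [hx]
      simp only [hΦ]; linear_combination (poissonMean k w x * slackTarget k y s S L w x -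
        C * poissonMean k (fun i => w i * i) x) * hee x
    rintro x (rfl | rfl)
    exacts [h5 _ hp2, h5 _ hp3]

theorem hasSum_perturbed {w : ℕ → ℝ} {ζ c₁ c₂ : ℝ} (H : GeomComparable w ζ c₁ c₂) {k C τ : ℝ}
    (hk : 0 < k) (hC : 0 ≤ C) (hτ : 0 ≤ τ) (p : Polynomial ℝ) (x : ℝ) :
    HasSum (fun i => perturbed k w C p τ i * poi (k * x) i)
      (poissonMean k (fun i => w i * Real.exp (-(τ * (C * i)))) x -
        τ * (Real.exp (-(k * x)) * p.eval x)) := by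
  have hE : ExpGrowth (fun i : ℕ => w i * Real.exp (-(τ * (C * i)))) :=
    H.expGrowth.mul (ExpGrowth.exp (K := 0) (D := 0) fun i => by
      have : 0 ≤ τ * (C * i) := by positivity
      linarith)
  refine ((hE.summable (k * x)).hasSum.sub ((hasSum_polyCoeff hk p x).mul_left τ)).congr_fun
    fun i => ?_
  rw [perturbed]; ring

/-- On [0, R] a second-order expansion lowers the logarithm by about τ times the target; the term -L
· slack of the target then costs τL · slack, which the available slack covers once τL ≤ 1. Beyond R
the factor exp(-τx) pays for τ|x - y|, and the polynomial only helps. -/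
theorem exists_perturbed_le {w : ℕ → ℝ} {ζ c₁ c₂ : ℝ} (H : GeomComparable w ζ c₁ c₂) {k : ℝ}
    (hk : 0 < k) {y s S L η C R τ₁ : ℝ} {p : Polynomial ℝ} (hy : 0 ≤ y)
    (hS : ∀ x, 0 ≤ x → s * |x - y| + Real.log (poissonMean k w x) ≤ S)
    (hL : 0 ≤ L) (hη : 0 < η) (hC : 0 ≤ C) (hyR : y ≤ R) (hτ₁ : 0 < τ₁)
    (htail : ∀ x, 0 ≤ x → R ≤ x → ∀ τ, 0 ≤ τ → τ ≤ τ₁ →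
        poissonMean k (fun i => w i * Real.exp (-(τ * (C * i)))) x ≤
          Real.exp (-(τ * x)) * poissonMean k w x)
    (hp : ∀ x, R ≤ x → 0 ≤ p.eval x)
    (hd : ∀ x ∈ Set.Icc 0 R, poissonMean k w x * (slackTarget k y s S L w x - η) ≤
        C * poissonMean k (fun i => w i * i) x + Real.exp (-(k * x)) * p.eval x) :
    ∃ τ₀, 0 < τ₀ ∧ ∀ τ, 0 < τ → τ ≤ τ₀ → (∀ i, 0 < perturbed k w C p τ i) → ∀ x, 0 ≤ x →
      (s + τ) * |x - y| + Real.log (poissonMean k (perturbed k w C p τ) x) ≤ S + 2 * η * τ := by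
  have hc₁ := H.lower_pos
  -- V bounds the second moment of the count relative to the mean of w, uniformly on [0, R].
  set V := (∑' i : ℕ, (w i * i * i) * ((k * R) ^ i / (i.factorial : ℝ))) / c₁ with hV
  have hV0 : 0 ≤ V := by
    have hR : 0 ≤ R := hy.trans hyR
    refine div_nonneg (tsum_nonneg fun i => ?_) hc₁.le
    have := H.pos i
    positivity
  -- The three limits on τ are for the tail bound, for τL ≤ 1, and for the quadratic error τC²V ≤ η.
  refine ⟨min (min τ₁ (1 / (L + 1))) (η / (C ^ 2 * V + 1)), by positivity,
    fun τ hτ hττ hpos x hx => ?_⟩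
  have hτ1 : τ ≤ τ₁ := hττ.trans ((min_le_left _ _).trans (min_le_left _ _))
  have hτ2 : τ ≤ 1 / (L + 1) := hττ.trans ((min_le_left _ _).trans (min_le_right _ _))
  have hτ3 : τ ≤ η / (C ^ 2 * V + 1) := hττ.trans (min_le_right _ _)
  rw [le_div_iff₀ (by positivity)] at hτ2 hτ3
  have hkx : 0 ≤ k * x := by positivity
  have hW := H.poissonMean_pos hkx
  have hsum := H.hasSum_perturbed hk hC hτ.le p x
  have hval := hsum.tsum_eq
  have hW' : 0 < poissonMean k (perturbed k w C p τ) x := by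
    refine hsum.summable.tsum_pos (fun i => mul_nonneg (hpos i).le (poi_nonneg hkx i)) 0
      (mul_pos (hpos 0) ?_)
    rw [poi_zero_right]; positivity
  change poissonMean k (perturbed k w C p τ) x = _ at hval
  rcases le_total x R with hxR | hxR
  · set W := poissonMean k w x with hWdef
    have hI2 : poissonMean k (fun i => w i * i * i) x ≤ V * W := by
      have h1 : poissonMean k (fun i => w i * i * i) x ≤ Real.exp (-(k * x)) *
          ∑' i : ℕ, (w i * i * i) * ((k * R) ^ i / (i.factorial : ℝ)) := by
        refine hasSum_le (fun i => ?_)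
          (H.expGrowth.mul_natCast.mul_natCast.summable (k * x)).hasSum
          ((H.expGrowth.mul_natCast.mul_natCast.summable_mul_pow_div (k * R)).hasSum.mul_left _)
        have := H.pos i
        rw [poi, mul_left_comm, mul_div_assoc]
        gcongr
      refine h1.trans ?_
      have h2 := H.le_poissonMean hkx
      calc _ = V * (c₁ * Real.exp (-(k * x))) := by rw [hV]; field_simp
        _ ≤ _ := by gcongr
    have hexp : poissonMean k (fun i => w i * Real.exp (-(τ * (C * i)))) x ≤
        W - τ * C * poissonMean k (fun i => w i * i) x +
          (τ * C) ^ 2 * poissonMean k (fun i => w i * i * i) x := by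
      have hE : ExpGrowth (fun i : ℕ => w i * Real.exp (-(τ * (C * i)))) :=
        H.expGrowth.mul (ExpGrowth.exp (K := 0) (D := 0) fun i => by
          have : 0 ≤ τ * (C * i) := by positivity
          linarith)
      refine hasSum_le (fun i => ?_) (hE.summable (k * x)).hasSum
        (((H.expGrowth.summable (k * x)).hasSum.sub
          ((H.expGrowth.mul_natCast.summable (k * x)).hasSum.mul_left (τ * C))).add
          ((H.expGrowth.mul_natCast.mul_natCast.summable (k * x)).hasSum.mul_left ((τ * C) ^ 2)))
      have h1 : Real.exp (-(τ * (C * i))) ≤ _ :=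
        exp_neg_le_one_sub_add_sq (by positivity : 0 ≤ τ * (C * i))
      calc _ ≤ w i * (1 - τ * (C * i) + (τ * (C * i)) ^ 2) * poi (k * x) i := by
            have := H.pos i
            have := poi_nonneg hkx i
            gcongr
        _ = _ := by ring
    have hdx := hd x ⟨hx, hxR⟩
    have hup : poissonMean k (perturbed k w C p τ) x ≤
        W * (1 - τ * (slackTarget k y s S L w x - η) + τ * η) := by
      have h3 : (τ * C) ^ 2 * poissonMean k (fun i => w i * i * i) x ≤ τ * η * W := by
        calc _ ≤ (τ * C) ^ 2 * (V * W) := by gcongr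
          _ = τ * (τ * (C ^ 2 * V)) * W := by ring
          _ ≤ τ * η * W := by gcongr; nlinarith
      have h4 := mul_le_mul_of_nonneg_left hdx hτ.le
      rw [hval]
      linarith
    have hlog : Real.log (poissonMean k (perturbed k w C p τ) x) ≤
        Real.log W - τ * (slackTarget k y s S L w x - η) + τ * η := by
      have h5 := Real.log_le_sub_one_of_pos (div_pos hW' hW)
      rw [Real.log_div hW'.ne' hW.ne'] at h5
      have h6 := (div_le_iff₀' hW).2 hup
      linarith
    have hSx := hS x hx
    rw [slackTarget] at hlog
    have h7 : 0 ≤ (1 - τ * L) * (S - s * |x - y| - Real.log W) :=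
      mul_nonneg (by linarith) (by linarith)
    linarith
  · have h1 := htail x hx hxR τ hτ.le hτ1
    have h2 : poissonMean k (perturbed k w C p τ) x ≤ Real.exp (-(τ * x)) * poissonMean k w x := by
      have := mul_nonneg hτ.le (mul_nonneg (Real.exp_pos (-(k * x))).le (hp x hxR))
      linarith
    have h3 := Real.log_le_log hW' h2
    rw [Real.log_mul (Real.exp_pos _).ne' hW.ne', Real.log_exp] at h3
    have h4 : τ * |x - y| ≤ τ * x := by
      rw [abs_of_nonneg (by linarith)]
      exact mul_le_mul_of_nonneg_left (by linarith) hτ.le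
    have := hS x hx
    have : 0 < η * τ := by positivity
    linarith

end GeomComparable

theorem hasSum_mixture_mul {k x₁ x₂ q₁ q₂ : ℝ} {w M f : ℕ → ℝ}
    (hM : ∀ i, M i = q₁ * poi (k * x₁) i + q₂ * poi (k * x₂) i)
    (hwf : ExpGrowth (fun i => w i * f i)) :
    HasSum (fun i => w i * M i * f i)
      (q₁ * poissonMean k (fun i => w i * f i) x₁ + q₂ * poissonMean k (fun i => w i * f i) x₂) := by
  refine (((hwf.summable (k * x₁)).hasSum.mul_left q₁).add
    ((hwf.summable (k * x₂)).hasSum.mul_left q₂)).congr_fun fun i => ?_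
  rw [hM]; ring

namespace GeomComparable

set_option maxHeartbeats 400000 in
-- To first order (w'/w)^(-θ) is 1 + θτg with g_i = C i + p̂_i/w_i, where p̂ is `polyCoeff`, and g
-- has weighted sum Z e. As |g| grows at most linearly, the quadratic remainder is summable against
-- the mixture.
theorem exists_perturbed_moment_le {w : ℕ → ℝ} {ζ c₁ c₂ : ℝ} (H : GeomComparable w ζ c₁ c₂) {k : ℝ}
    (hk : 0 < k) {x₁ x₂ q₁ q₂ θ η C : ℝ} {M : ℕ → ℝ} (p : Polynomial ℝ)
    (hx₁ : 0 ≤ x₁) (hx₂ : 0 ≤ x₂) (hq₁ : 0 < q₁) (hq₂ : 0 < q₂)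
    (hM : ∀ i, M i = q₁ * poi (k * x₁) i + q₂ * poi (k * x₂) i)
    (hθ : 0 < θ) (hη : 0 < η) (hC : 0 ≤ C) {Z e : ℝ}
    (hZ : Z = q₁ * poissonMean k w x₁ + q₂ * poissonMean k w x₂)
    (he : q₁ * (C * poissonMean k (fun i => w i * i) x₁ + Real.exp (-(k * x₁)) * p.eval x₁) +
      q₂ * (C * poissonMean k (fun i => w i * i) x₂ + Real.exp (-(k * x₂)) * p.eval x₂) = Z * e) :
    ∃ τ₀, 0 < τ₀ ∧ ∀ τ, 0 < τ → τ ≤ τ₀ → (∀ i, 0 < perturbed k w C p τ i) ∧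
      Summable (fun i => w i * M i * (perturbed k w C p τ i / w i) ^ (-θ)) ∧
      ∑' i, w i * M i * (perturbed k w C p τ i / w i) ^ (-θ) ≤
        Z * Real.exp (θ * τ * (e + η)) := by
  set N := p.natDegree + 1 with hN
  set g : ℕ → ℝ := fun i => C * i + polyCoeff k p i / w i with hg
  set K := ∑ i ∈ Finset.range N, |g i| + 1 with hK
  have hK1 : 1 ≤ K := by
    have : 0 ≤ ∑ i ∈ Finset.range N, |g i| := Finset.sum_nonneg fun _ _ => abs_nonneg _
    linarith
  have hgK : ∀ i, i < N → |g i| ≤ K := fun i hi => by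
    have := Finset.single_le_sum (f := fun j => |g j|) (fun _ _ => abs_nonneg _)
      (Finset.mem_range.2 hi)
    linarith
  have hgN : ∀ i, N ≤ i → g i = C * i := fun i hi => by
    simp only [hg]; rw [polyCoeff_eq_zero hi]; simp
  have hgb : ∀ i, |g i| ≤ K + C * i := fun i => by
    have hCi : 0 ≤ C * i := by positivity
    rcases lt_or_ge i N with hi | hi
    · linarith [hgK i hi]
    · rw [hgN i hi, abs_of_nonneg hCi]; linarith
  have hgE : ExpGrowth g :=
    ((ExpGrowth.const K).add ((ExpGrowth.const C).mul ExpGrowth.natCast)).of_abs_le hgb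
  have hxp : ExpGrowth (fun i => Real.exp (θ * |g i|)) :=
    ExpGrowth.exp (K := θ * K) (D := θ * C) fun i => by
      have := mul_le_mul_of_nonneg_left (hgb i) hθ.le
      linarith
  have hMpos : ∀ i, 0 < M i ∨ M i = 0 := fun i => by
    have h1 := poi_nonneg (mul_nonneg hk.le hx₁) i
    have h2 := poi_nonneg (mul_nonneg hk.le hx₂) i
    have : 0 ≤ M i := by rw [hM]; positivity
    rcases this.lt_or_eq with h | h
    exacts [Or.inl h, Or.inr h.symm]
  have hM0 : ∀ i, 0 ≤ M i := fun i => by rcases hMpos i with h | h <;> linarith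
  have hwg : ExpGrowth (fun i => w i * g i) := H.expGrowth.mul hgE
  have s0 : HasSum (fun i => w i * M i) Z := by
    have := hasSum_mixture_mul (f := fun _ => 1) hM (by simpa using H.expGrowth)
    simpa [hZ] using this
  have s1 : HasSum (fun i => w i * M i * g i) (Z * e) := by
    have h1 : ∀ x, poissonMean k (fun i => w i * g i) x =
        C * poissonMean k (fun i => w i * i) x + Real.exp (-(k * x)) * p.eval x := fun x => by
      refine HasSum.tsum_eq ((((H.expGrowth.mul_natCast.summable (k * x)).hasSum.mul_left C).add
        (hasSum_polyCoeff hk p x)).congr_fun fun i => ?_)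
      have := (H.pos i).ne'
      simp only [hg]; field_simp
    rw [← he, ← h1, ← h1]
    exact hasSum_mixture_mul hM hwg
  set f₂ : ℕ → ℝ := fun i => θ ^ 2 * g i * g i * Real.exp (θ * |g i|) with hf₂
  have hwv : ExpGrowth (fun i => w i * f₂ i) :=
    H.expGrowth.mul ((((ExpGrowth.const (θ ^ 2)).mul hgE).mul hgE).mul hxp)
  set V := q₁ * poissonMean k (fun i => w i * f₂ i) x₁ + q₂ * poissonMean k (fun i => w i * f₂ i) x₂
  have s2 : HasSum (fun i => w i * M i * f₂ i) V := hasSum_mixture_mul hM hwv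
  have hV0 : 0 ≤ V := s2.nonneg fun i => by
    have := H.pos i; have := hM0 i
    simp only [hf₂]
    rw [mul_assoc (θ ^ 2)]
    have := mul_self_nonneg (g i)
    positivity
  have hZ0 : 0 < Z := by
    have h1 := H.poissonMean_pos (mul_nonneg hk.le hx₁)
    have h2 := H.poissonMean_pos (mul_nonneg hk.le hx₂)
    rw [hZ]; positivity
  set D := V / Z + 2 * θ * K ^ 2 with hD
  have hD0 : 0 ≤ D := by positivity
  -- The first limit gives |τ g_i| ≤ 1/2 for i < N, where 1 - t ≥ exp(-t - 2t²) applies; the second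
  -- makes the quadratic errors at most θη τ.
  refine ⟨min (1 / (2 * K)) (θ * η / (D + 1)), by positivity, fun τ hτ hττ => ?_⟩
  have hτ1 : τ ≤ 1 / (2 * K) := hττ.trans (min_le_left _ _)
  have hτ2 : τ ≤ θ * η / (D + 1) := hττ.trans (min_le_right _ _)
  rw [le_div_iff₀ (by positivity)] at hτ1 hτ2
  have hτ3 : τ ≤ 1 := by nlinarith
  have hlow : ∀ i, Real.exp (-(τ * g i + 2 * τ ^ 2 * K ^ 2)) ≤ perturbed k w C p τ i / w i := by
    intro i
    have hwi := (H.pos i).ne'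
    have h1 : perturbed k w C p τ i / w i =
        Real.exp (-(τ * (C * i))) - τ * (polyCoeff k p i / w i) := by
      rw [perturbed]; field_simp
    rw [h1]
    -- The polynomial part affects only the indices below N. From N on the ratio is exactly exp(-τ C
    -- i), so no uniform smallness is needed.
    rcases lt_or_ge i N with hi | hi
    · have hgi := hgK i hi
      have h2 : |τ * g i| ≤ 1 / 2 := by
        rw [abs_mul, abs_of_pos hτ]; nlinarith
      have h3 := exp_neg_sub_le_one_sub h2
      have h4 : g i ^ 2 ≤ K ^ 2 := by rw [← sq_abs]; gcongr
      have h5 : Real.exp (-(τ * g i + 2 * τ ^ 2 * K ^ 2)) ≤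
          Real.exp (-(τ * g i) - 2 * (τ * g i) ^ 2) := by
        refine Real.exp_le_exp.2 ?_
        have := mul_le_mul_of_nonneg_left h4 (sq_nonneg τ)
        rw [mul_pow]; linarith
      have h6 := Real.add_one_le_exp (-(τ * (C * i)))
      have h7 : τ * g i = τ * (C * i) + τ * (polyCoeff k p i / w i) := by simp only [hg]; ring
      linarith
    · rw [polyCoeff_eq_zero hi, hgN i hi]
      simp only [zero_div, mul_zero, sub_zero]
      refine Real.exp_le_exp.2 ?_
      have : 0 ≤ 2 * τ ^ 2 * K ^ 2 := by positivity
      linarith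
  have hratio : ∀ i, 0 < perturbed k w C p τ i / w i := fun i => (Real.exp_pos _).trans_le (hlow i)
  have hpos : ∀ i, 0 < perturbed k w C p τ i := fun i => by
    have := hratio i
    rwa [div_pos_iff_of_pos_right (H.pos i)] at this
  have hterm : ∀ i, w i * M i * (perturbed k w C p τ i / w i) ^ (-θ) ≤
      Real.exp (2 * θ * τ ^ 2 * K ^ 2) * (w i * M i + θ * τ * (w i * M i * g i) +
        τ ^ 2 * (w i * M i * (θ ^ 2 * g i * g i * Real.exp (θ * |g i|)))) := by
    intro i
    have h1 := Real.rpow_le_rpow_of_nonpos (Real.exp_pos _) (hlow i) (by linarith : -θ ≤ 0)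
    rw [← Real.exp_mul, show -(τ * g i + 2 * τ ^ 2 * K ^ 2) * -θ =
      2 * θ * τ ^ 2 * K ^ 2 + θ * τ * g i by ring, Real.exp_add] at h1
    have h2 : Real.exp (θ * τ * g i) ≤ 1 + θ * τ * g i +
        τ ^ 2 * (θ ^ 2 * g i * g i * Real.exp (θ * |g i|)) := by
      refine (exp_le_one_add_add_sq _).trans ?_
      have h3 : Real.exp |θ * τ * g i| ≤ Real.exp (θ * |g i|) := by
        refine Real.exp_le_exp.2 ?_
        rw [abs_mul, abs_of_pos (by positivity)]
        have := abs_nonneg (g i)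
        calc θ * τ * |g i| ≤ θ * 1 * |g i| := by gcongr
          _ = _ := by ring
      have := mul_le_mul_of_nonneg_left h3 (sq_nonneg (θ * τ * g i))
      linarith
    have hwM : 0 ≤ w i * M i := mul_nonneg (H.pos i).le (hM0 i)
    calc _ ≤ w i * M i * (Real.exp (2 * θ * τ ^ 2 * K ^ 2) * Real.exp (θ * τ * g i)) := by gcongr
      _ ≤ w i * M i * (Real.exp (2 * θ * τ ^ 2 * K ^ 2) * (1 + θ * τ * g i +
        τ ^ 2 * (θ ^ 2 * g i * g i * Real.exp (θ * |g i|)))) := by gcongr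
      _ = _ := by ring
  have hsum := ((s0.add (s1.mul_left (θ * τ))).add (s2.mul_left (τ ^ 2))).mul_left
    (Real.exp (2 * θ * τ ^ 2 * K ^ 2))
  have hsumm : Summable (fun i => w i * M i * (perturbed k w C p τ i / w i) ^ (-θ)) :=
    Summable.of_nonneg_of_le (fun i => mul_nonneg (mul_nonneg (H.pos i).le (hM0 i))
      (Real.rpow_nonneg (hratio i).le _)) hterm hsum.summable
  refine ⟨hpos, hsumm, (hasSum_le hterm hsumm.hasSum hsum).trans ?_⟩
  have h1 : Z + θ * τ * (Z * e) + τ ^ 2 * V = Z * ((θ * τ * e + τ ^ 2 * (V / Z)) + 1) := by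
    field_simp
    ring
  rw [h1]
  calc _ ≤ Real.exp (2 * θ * τ ^ 2 * K ^ 2) * (Z * Real.exp (θ * τ * e + τ ^ 2 * (V / Z))) := by
        have := Real.add_one_le_exp (θ * τ * e + τ ^ 2 * (V / Z))
        gcongr
    _ = Z * Real.exp (2 * θ * τ ^ 2 * K ^ 2 + (θ * τ * e + τ ^ 2 * (V / Z))) := by
        rw [Real.exp_add (2 * θ * τ ^ 2 * K ^ 2)]; ring
    _ ≤ _ := by
        refine mul_le_mul_of_nonneg_left (Real.exp_le_exp.2 ?_) hZ0.le
        have h2 : τ * (τ * D) ≤ τ * (θ * η) :=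
          mul_le_mul_of_nonneg_left (by nlinarith) hτ.le
        rw [hD] at h2
        linarith

/-- Every target slack is, to first order, attained by perturbing the weights of one level: the
constraint with slope `s` becomes one with slope `s + τ` at almost no cost, while the moment of the
mixture grows by the mean of the target. -/
theorem exists_perturbation {w : ℕ → ℝ} {ζ c₁ c₂ : ℝ} (H : GeomComparable w ζ c₁ c₂) {k : ℝ}
    (hk : 0 < k) {y s S L η x₁ x₂ q₁ q₂ θ : ℝ} {M : ℕ → ℝ} (hy : 0 ≤ y)
    (hS : ∀ x, 0 ≤ x → s * |x - y| + Real.log (poissonMean k w x) ≤ S)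
    (hx₁ : 0 ≤ x₁) (hx₁₂ : x₁ < x₂) (hq₁ : 0 < q₁) (hq₂ : 0 < q₂)
    (hM : ∀ i, M i = q₁ * poi (k * x₁) i + q₂ * poi (k * x₂) i)
    (hL : 0 ≤ L) (hη : 0 < η) (hθ : 0 < θ) {Z e : ℝ}
    (hZ : Z = q₁ * poissonMean k w x₁ + q₂ * poissonMean k w x₂)
    (he : q₁ * (poissonMean k w x₁ * slackTarget k y s S L w x₁) +
      q₂ * (poissonMean k w x₂ * slackTarget k y s S L w x₂) = Z * e) :
    ∃ τ₀, 0 < τ₀ ∧ ∀ τ, 0 < τ → τ ≤ τ₀ → ∃ w' : ℕ → ℝ, (∀ i, 0 < w' i) ∧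
      (∀ x, 0 ≤ x → Summable (fun i => w' i * poi (k * x) i) ∧
        (s + τ) * |x - y| + Real.log (poissonMean k w' x) ≤ S + η * τ) ∧
      Summable (fun i => w i * M i * (w' i / w i) ^ (-θ)) ∧
      ∑' i, w i * M i * (w' i / w i) ^ (-θ) ≤ Z * Real.exp (θ * τ * (e + η)) := by
  obtain ⟨C, R, τ₁, p, hC, hyR, hτ₁, htail, hp, hd, hd'⟩ :=
    H.exists_direction hk (y := y) (s := s) (S := S) (L := L) hx₁ hx₁₂ (half_pos hη)
  obtain ⟨τ₂, hτ₂, h₂⟩ := H.exists_perturbed_le hk hy hS hL (half_pos hη) hC hyR hτ₁ htail hp hd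
  obtain ⟨τ₃, hτ₃, h₃⟩ := H.exists_perturbed_moment_le hk p hx₁ (hx₁.trans hx₁₂.le) hq₁ hq₂ hM hθ
    hη hC hZ (e := e) (by rw [hd' _ (Or.inl rfl), hd' _ (Or.inr rfl), he])
  refine ⟨min τ₂ τ₃, lt_min hτ₂ hτ₃, fun τ hτ hττ => ?_⟩
  obtain ⟨hpos, hs, hle⟩ := h₃ τ hτ (hττ.trans (min_le_right _ _))
  refine ⟨perturbed k w C p τ, hpos, fun x hx =>
    ⟨(H.hasSum_perturbed hk hC hτ.le p x).summable, ?_⟩, hs, hle⟩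
  have := h₂ τ hτ (hττ.trans (min_le_left _ _)) hpos x hx
  linarith

end GeomComparable

/-! ### The objective in terms of real numbers -/

theorem coe_finset_sum {α : Type*} (s : Finset α) (f : α → ℝ) :
    ((∑ a ∈ s, f a : ℝ) : EReal) = ∑ a ∈ s, (f a : EReal) := by
  classical
  induction s using Finset.induction_on with
  | empty => simp
  | insert a s ha ih => rw [Finset.sum_insert ha, Finset.sum_insert ha, EReal.coe_add, ih]

theorem sum_ne_bot {α : Type*} (s : Finset α) (f : α → EReal) (h : ∀ a ∈ s, f a ≠ ⊥) :
    ∑ a ∈ s, f a ≠ ⊥ := by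
  classical
  induction s using Finset.induction_on with
  | empty => simp
  | insert a s ha ih =>
    rw [Finset.sum_insert ha]
    exact EReal.add_ne_bot_iff.2 ⟨h a (Finset.mem_insert_self _ _),
      ih fun b hb => h b (Finset.mem_insert_of_mem hb)⟩

theorem logMgf_eq_log {t r V : ℝ} {c : ℕ → ℝ} (hr : 0 ≤ r)
    (h : HasSum (fun i => Real.exp (t * c i) * poi r i) V) (hV : 0 < V) :
    logMgf t c r = (Real.log V : EReal) := by
  rw [logMgf, ← ENNReal.ofReal_tsum_of_nonneg
    (fun i => mul_nonneg (Real.exp_pos _).le (poi_nonneg hr i)) h.summable, h.tsum_eq,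
    ENNReal.log_ofReal_of_pos hV]

theorem logMgf_ne_bot {t r : ℝ} {c : ℕ → ℝ} : logMgf t c r ≠ ⊥ := by
  rw [logMgf, Ne, ENNReal.log_eq_bot_iff, ENNReal.tsum_eq_zero]
  intro h
  have h0 := h 0
  rw [poi_zero_right, ENNReal.ofReal_eq_zero] at h0
  exact absurd h0 (not_le.2 (by positivity))

theorem logMgf_zero_left {r : ℝ} {c : ℕ → ℝ} (hr : 0 ≤ r) : logMgf 0 c r = 0 := by
  rw [logMgf_eq_log hr (V := 1) (by simpa using hasSum_poi r) one_pos]; simp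

theorem logMgf_add_const (t r κ₀ : ℝ) (c : ℕ → ℝ) :
    logMgf t (fun i => c i + κ₀) r = ((t * κ₀ : ℝ) : EReal) + logMgf t c r := by
  have h : ∀ i, ENNReal.ofReal (Real.exp (t * (c i + κ₀)) * poi r i) =
      ENNReal.ofReal (Real.exp (t * κ₀)) * ENNReal.ofReal (Real.exp (t * c i) * poi r i) :=
    fun i => by
      rw [← ENNReal.ofReal_mul (Real.exp_pos _).le, ← mul_assoc, ← Real.exp_add]
      ring_nf
  rw [logMgf, logMgf, tsum_congr h, ENNReal.tsum_mul_left, ENNReal.log_mul_add,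
    ENNReal.log_ofReal_of_pos (Real.exp_pos _), Real.log_exp]

theorem mult_pos {ι : Type*} [Fintype ι] {P : ι → ℝ} {y : ℝ} (hy : y ∈ levels P) :
    0 < mult P y := by
  obtain ⟨a, -, rfl⟩ := Finset.mem_image.1 hy
  exact Finset.card_pos.2 ⟨a, by simp⟩

theorem IsHypothesis.level_pos {ι : Type*} [Fintype ι] {P : ι → ℝ} (hP : IsHypothesis P) {y : ℝ}
    (hy : y ∈ levels P) : 0 < y := by
  obtain ⟨a, -, rfl⟩ := Finset.mem_image.1 hy
  exact hP.1 a

theorem IsHypothesis.nonempty {ι : Type*} [Fintype ι] {P : ι → ℝ} (hP : IsHypothesis P) :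
    Nonempty ι := by
  by_contra h
  rw [not_nonempty_iff] at h
  simpa using hP.2

theorem IsHypothesis.levels_nonempty {ι : Type*} [Fintype ι] {P : ι → ℝ} (hP : IsHypothesis P) :
    (levels P).Nonempty := by
  have := hP.nonempty
  exact Finset.univ_nonempty.image P

theorem sum_levels {ι : Type*} [Fintype ι] (P : ι → ℝ) (f : ℝ → ℝ) :
    ∑ y ∈ levels P, (mult P y : ℝ) * f y = ∑ a, f (P a) := by
  rw [Finset.sum_comp f P]
  simp [levels, mult, nsmul_eq_mul]

/-- The real value that the merged objective takes when the logarithms are `a y` and the suprema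
are `s y`. -/
noncomputable def mergedValue {ι : Type*} [Fintype ι] (P : ι → ℝ) (ε α u : ℝ) (a s : ℝ → ℝ) : ℝ :=
  ε * α * (1 - u) +
    ∑ y ∈ levels P, (u * mult P y * a y + (1 - u) * mult P y * s y)

theorem mergedValue_eq {ι : Type*} [Fintype ι] (P : ι → ℝ) (ε α u : ℝ) (a s : ℝ → ℝ) :
    mergedValue P ε α u a s = u * ∑ y ∈ levels P, (mult P y : ℝ) * a y +
      (1 - u) * (ε * α + ∑ y ∈ levels P, (mult P y : ℝ) * s y) := by
  rw [mergedValue, Finset.sum_add_distrib, mul_add, Finset.mul_sum, Finset.mul_sum]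
  simp only [mul_assoc]
  ring

theorem mergedObjective_le {ι : Type*} [Fintype ι] {P : ι → ℝ} {k ε α u : ℝ} {κ : ℕ → ℝ → ℝ}
    {a s : ℝ → ℝ} (hu : u ∈ Set.Icc (0 : ℝ) 1)
    (ha : ∀ y ∈ levels P, logMgf (1 - u) (fun i => κ i y) (k * y) ≤ (a y : EReal))
    (hs : ∀ y ∈ levels P, ∀ x : ℝ≥0,
      logMgf (-u) (fun i => κ i y) (k * x) ≤ ((s y + α * |(x : ℝ) - y| : ℝ) : EReal)) :
    mergedObjective P k ε α u κ ≤ (mergedValue P ε α u a s : EReal) := by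
  rw [mergedObjective, mergedValue, EReal.coe_add, coe_finset_sum]
  refine add_le_add le_rfl (Finset.sum_le_sum fun y hy => ?_)
  rw [EReal.coe_add, EReal.coe_mul _ (a y), EReal.coe_mul _ (s y)]
  refine add_le_add (mul_le_mul_of_nonneg_left (ha y hy) ?_)
    (mul_le_mul_of_nonneg_left (iSup_le fun x => ?_) ?_)
  · exact EReal.coe_nonneg.2 (mul_nonneg hu.1 (Nat.cast_nonneg _))
  · refine (add_le_add le_rfl (hs y hy x)).trans ?_
    rw [← EReal.coe_add, EReal.coe_le_coe_iff]
    linarith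
  · exact EReal.coe_nonneg.2 (mul_nonneg (by linarith [hu.2]) (Nat.cast_nonneg _))

/-- With exponents -u and 1 - u the two Chernoff bounds are at most B and A. Adding κ₀ to all
coefficients moves these to B - uκ₀n and A + (1-u)κ₀n, and the choice of κ₀ makes both equal to uA +
(1-u)B. The distance constraint enters through α ≤ 0. -/
theorem Delta_le {ι : Type*} [Fintype ι] {P : ι → ℝ} (hP : IsHypothesis P) {k ε α u : ℝ}
    {κ : ℕ → ℝ → ℝ} {a s : ℝ → ℝ} (hα : α ≤ 0) (hu : u ∈ Set.Icc (0 : ℝ) 1)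
    (ha : ∀ y ∈ levels P, logMgf (1 - u) (fun i => κ i y) (k * y) ≤ (a y : EReal))
    (hs : ∀ y ∈ levels P, ∀ x : ℝ≥0,
      logMgf (-u) (fun i => κ i y) (k * x) ≤ ((s y + α * |(x : ℝ) - y| : ℝ) : EReal)) :
    Delta P k ε ≤ (mergedValue P ε α u a s : EReal) := by
  set n : ℝ := ∑ y ∈ levels P, (mult P y : ℝ) with hn
  have hn0 : 0 < n := Finset.sum_pos (fun y hy => Nat.cast_pos.2 (mult_pos hy)) hP.levels_nonempty
  set A := ∑ y ∈ levels P, (mult P y : ℝ) * a y with hA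
  set B := ε * α + ∑ y ∈ levels P, (mult P y : ℝ) * s y with hB
  set κ₀ := (B - A) / n with hκ₀
  have hκn : κ₀ * n = B - A := by rw [hκ₀]; field_simp
  rw [mergedValue_eq, ← hA, ← hB]
  refine (iInf_le _ fun i y => κ i y + κ₀).trans (max_le (iSup_le fun ⟨h, hfar, hcount⟩ => ?_) ?_)
  · refine (iInf_le _ ⟨-u, by simpa using hu.1⟩).trans ?_
    have h1 : ∀ y ∈ levels P, ∀ x : ℝ≥0, logMgf (-u) (fun i => κ i y + κ₀) (k * x) ≤
        ((-u * κ₀ + s y + α * |(x : ℝ) - y| : ℝ) : EReal) := fun y hy x => by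
      rw [logMgf_add_const, add_assoc, EReal.coe_add]
      exact add_le_add le_rfl (hs y hy x)
    calc _ ≤ ∑ y ∈ levels P, ∑ x ∈ (h y).support,
          (((h y x : ℝ) * (-u * κ₀ + s y + α * |(x : ℝ) - y|) : ℝ) : EReal) := by
          refine Finset.sum_le_sum fun y hy => Finset.sum_le_sum fun x _ => ?_
          rw [EReal.coe_mul]
          exact mul_le_mul_of_nonneg_left (h1 y hy x) (EReal.coe_nonneg.2 (h y x).2)
      _ = ((∑ y ∈ levels P, ∑ x ∈ (h y).support,
          ((h y x : ℝ) * (-u * κ₀ + s y + α * |(x : ℝ) - y|)) : ℝ) : EReal) := by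
          simp only [coe_finset_sum]
      _ ≤ _ := by
          rw [EReal.coe_le_coe_iff]
          have e1 : ∀ y ∈ levels P, ∑ x ∈ (h y).support,
              ((h y x : ℝ) * (-u * κ₀ + s y + α * |(x : ℝ) - y|)) =
              (mult P y : ℝ) * (-u * κ₀) + (mult P y : ℝ) * s y +
              α * (h y).sum (fun x w => (w : ℝ) * |(x : ℝ) - y|) := fun y hy => by
            rw [← hcount y hy, Finsupp.sum, Finsupp.sum, Finset.sum_mul, Finset.sum_mul,
              Finset.mul_sum, ← Finset.sum_add_distrib, ← Finset.sum_add_distrib]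
            exact Finset.sum_congr rfl fun x _ => by ring
          rw [Finset.sum_congr rfl e1, Finset.sum_add_distrib, Finset.sum_add_distrib,
            ← Finset.mul_sum, ← Finset.sum_mul, ← hn]
          have := mul_le_mul_of_nonpos_left hfar hα
          linear_combination this - u * hκn
  · refine (iInf_le _ ⟨1 - u, by simpa using hu.2⟩).trans ?_
    calc _ ≤ ∑ y ∈ levels P, (((mult P y : ℝ) * ((1 - u) * κ₀ + a y) : ℝ) : EReal) := by
          refine Finset.sum_le_sum fun y hy => ?_
          rw [EReal.coe_mul]
          refine mul_le_mul_of_nonneg_left ?_ (EReal.coe_nonneg.2 (Nat.cast_nonneg _))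
          rw [logMgf_add_const, EReal.coe_add]
          exact add_le_add le_rfl (ha y hy)
      _ = ((∑ y ∈ levels P, ((mult P y : ℝ) * ((1 - u) * κ₀ + a y)) : ℝ) : EReal) := by
          simp only [coe_finset_sum]
      _ ≤ _ := by
          rw [EReal.coe_le_coe_iff]
          simp only [mul_add, Finset.sum_add_distrib]
          rw [← Finset.sum_mul, ← hn, ← hA]
          linear_combination (1 - u) * hκn

/-- A finite value of the merged objective is attained by real values of its suprema. -/
theorem exists_mergedObjective_eq {ι : Type*} [Fintype ι] {P : ι → ℝ} {k ε α u : ℝ}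
    {κ : ℕ → ℝ → ℝ} {a : ℝ → ℝ} (hu1 : u < 1)
    (ha : ∀ y ∈ levels P, logMgf (1 - u) (fun i => κ i y) (k * y) = (a y : EReal))
    (hfin : mergedObjective P k ε α u κ < ⊤) :
    ∃ s : ℝ → ℝ, (∀ y ∈ levels P, ∀ x : ℝ≥0,
      logMgf (-u) (fun i => κ i y) (k * x) ≤ ((s y + α * |(x : ℝ) - y| : ℝ) : EReal)) ∧
      mergedObjective P k ε α u κ = (mergedValue P ε α u a s : EReal) := by
  set F : ℝ → EReal := fun y =>
    ⨆ x : ℝ≥0, (((-α * |(x : ℝ) - y| : ℝ) : EReal) + logMgf (-u) (fun i => κ i y) (k * x)) with hF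
  have hFbot : ∀ y, F y ≠ ⊥ := fun y h => by
    have h1 := le_iSup (fun x : ℝ≥0 =>
      ((-α * |(x : ℝ) - y| : ℝ) : EReal) + logMgf (-u) (fun i => κ i y) (k * x)) 0
    change _ ≤ F y at h1
    rw [h, le_bot_iff, EReal.add_eq_bot_iff] at h1
    exact h1.elim (EReal.coe_ne_bot _) logMgf_ne_bot
  have hpos : ∀ y ∈ levels P, 0 < (1 - u) * mult P y := fun y hy =>
    mul_pos (by linarith) (Nat.cast_pos.2 (mult_pos hy))
  have hterm : ∀ y ∈ levels P, ((u * mult P y : ℝ) : EReal) *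
      logMgf (1 - u) (fun i => κ i y) (k * y) + (((1 - u) * mult P y : ℝ) : EReal) * F y ≠ ⊥ := by
    intro y hy
    rw [ha y hy, ← EReal.coe_mul]
    refine EReal.add_ne_bot_iff.2 ⟨EReal.coe_ne_bot _, ?_⟩
    by_cases h : F y = ⊤
    · rw [h, EReal.coe_mul_top_of_pos (hpos y hy)]; exact top_ne_bot
    · rw [← EReal.coe_toReal h (hFbot y), ← EReal.coe_mul]; exact EReal.coe_ne_bot _
  -- One infinite supremum would make the whole objective ⊤: its coefficient (1-u)N_y is positive
  -- and no other summand is ⊥.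
  have hFtop : ∀ y ∈ levels P, F y ≠ ⊤ := by
    intro y hy h
    refine hfin.ne ?_
    rw [mergedObjective, ← Finset.add_sum_erase _ _ hy]
    change _ + ((((u * mult P y : ℝ) : EReal) *
      logMgf (1 - u) (fun i => κ i y) (k * y) + (((1 - u) * mult P y : ℝ) : EReal) * F y) + _) = ⊤
    rw [h, ha y hy, ← EReal.coe_mul, EReal.coe_mul_top_of_pos (hpos y hy), EReal.coe_add_top,
      EReal.top_add_of_ne_bot, EReal.coe_add_top]
    exact sum_ne_bot _ _ fun z hz => hterm z (Finset.mem_of_mem_erase hz)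
  have hFs : ∀ y ∈ levels P, F y = ((F y).toReal : EReal) := fun y hy =>
    (EReal.coe_toReal (hFtop y hy) (hFbot y)).symm
  refine ⟨fun y => (F y).toReal, fun y hy x => ?_, ?_⟩
  · have h1 := le_iSup (fun x : ℝ≥0 =>
      ((-α * |(x : ℝ) - y| : ℝ) : EReal) + logMgf (-u) (fun i => κ i y) (k * x)) x
    change _ ≤ F y at h1
    rw [hFs y hy] at h1
    generalize logMgf (-u) (fun i => κ i y) (k * x) = l at h1 ⊢
    induction l using EReal.rec with
    | bot => exact bot_le
    | top => rw [EReal.coe_add_top, top_le_iff] at h1; exact absurd h1 (EReal.coe_ne_top _)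
    | coe l =>
      rw [← EReal.coe_add, EReal.coe_le_coe_iff] at h1
      rw [EReal.coe_le_coe_iff]; linarith
  · rw [mergedObjective, mergedValue, EReal.coe_add, coe_finset_sum]
    congr 1
    refine Finset.sum_congr rfl fun y hy => ?_
    change ((u * mult P y : ℝ) : EReal) * logMgf (1 - u) (fun i => κ i y) (k * y) +
      (((1 - u) * mult P y : ℝ) : EReal) * F y = _
    rw [EReal.coe_add, EReal.coe_mul _ (a y), EReal.coe_mul _ (F y).toReal, ha y hy, ← hFs y hy]

/-! ### The optimal value is negative -/

theorem hasSum_single_zero_mul_poi (d r : ℝ) :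
    HasSum (fun i => (if i = 0 then d else 0) * poi r i) (d * Real.exp (-r)) := by
  have := hasSum_single (f := fun i => (if i = 0 then d else 0) * poi r i) 0
    (fun i hi => by simp [hi])
  simpa [poi_zero_right] using this

/-- Geometric weights of ratio `z` whose zeroth term is lowered by `δ`. -/
noncomputable def dippedWeight (z δ : ℝ) (i : ℕ) : ℝ := z ^ i - if i = 0 then δ else 0

theorem dippedWeight_pos {z δ : ℝ} (hz : 0 < z) (hδ : δ < 1) (i : ℕ) : 0 < dippedWeight z δ i := by
  rw [dippedWeight]
  split_ifs with h
  · rw [h]; simpa using hδ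
  · rw [sub_zero]; positivity

theorem logMgf_dippedWeight_le {z δ r : ℝ} (hz : 0 < z) (hz1 : z ≤ 1) (hδ0 : 0 ≤ δ) (hδ : δ < 1)
    (hr : 0 ≤ r) :
    logMgf (-(1 / 2)) (fun i => -2 * Real.log (dippedWeight z δ i)) r ≤
      ((-(r * (1 - z)) - δ * Real.exp (-r) : ℝ) : EReal) := by
  have hs : HasSum (fun i => Real.exp (-(1 / 2) * (-2 * Real.log (dippedWeight z δ i))) * poi r i)
      (Real.exp (-(r * (1 - z))) - δ * Real.exp (-r)) := by
    refine ((hasSum_pow_mul_poi z r).sub (hasSum_single_zero_mul_poi δ r)).congr_fun fun i => ?_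
    rw [show -(1 / 2) * (-2 * Real.log (dippedWeight z δ i)) = Real.log (dippedWeight z δ i) by ring,
      Real.exp_log (dippedWeight_pos hz hδ i), dippedWeight]
    ring
  have h1 : Real.exp (-r) ≤ Real.exp (-(r * (1 - z))) := Real.exp_le_exp.2 (by nlinarith)
  have h2 : Real.exp (-(r * (1 - z))) ≤ 1 := Real.exp_le_one_iff.2 (by
    have := mul_nonneg hr (sub_nonneg.2 hz1); linarith)
  have h3 := Real.exp_pos (-r)
  have hV : 0 < Real.exp (-(r * (1 - z))) - δ * Real.exp (-r) := by nlinarith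
  rw [logMgf_eq_log hr hs hV, EReal.coe_le_coe_iff, Real.log_le_iff_le_exp hV,
    sub_eq_add_neg (-(r * (1 - z))), Real.exp_add]
  have h4 := Real.add_one_le_exp (-(δ * Real.exp (-r)))
  have h5 := mul_le_mul_of_nonneg_left h4 (Real.exp_pos (-(r * (1 - z)))).le
  have h6 : 0 ≤ δ * Real.exp (-r) := by positivity
  nlinarith

theorem logMgf_dippedWeight_inv_le {z δ r : ℝ} (hz : 0 < z) (hz1 : z ≤ 1) (hδ0 : 0 ≤ δ)
    (hδ : δ < 1) (hr : 0 ≤ r) :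
    logMgf (1 - 1 / 2) (fun i => -2 * Real.log (dippedWeight z δ i)) r ≤
      ((r * (z⁻¹ - 1) + δ / (1 - δ) * Real.exp (-r) : ℝ) : EReal) := by
  have hd : 0 < 1 - δ := by linarith
  have hs : HasSum (fun i => Real.exp ((1 - 1 / 2) * (-2 * Real.log (dippedWeight z δ i))) * poi r i)
      (Real.exp (-(r * (1 - z⁻¹))) + δ / (1 - δ) * Real.exp (-r)) := by
    refine ((hasSum_pow_mul_poi z⁻¹ r).add (hasSum_single_zero_mul_poi (δ / (1 - δ)) r)).congr_fun
      fun i => ?_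
    rw [show (1 - 1 / 2) * (-2 * Real.log (dippedWeight z δ i)) =
      -Real.log (dippedWeight z δ i) by ring, Real.exp_neg,
      Real.exp_log (dippedWeight_pos hz hδ i), dippedWeight]
    split_ifs with h
    · subst h; simp only [pow_zero]; field_simp; ring
    · simp
  have h1 : 1 ≤ Real.exp (-(r * (1 - z⁻¹))) := Real.one_le_exp (by
    have := mul_nonneg hr (sub_nonneg.2 ((one_le_inv₀ hz).2 hz1)); linarith)
  have h3 := Real.exp_pos (-r)
  have h6 : 0 ≤ δ / (1 - δ) * Real.exp (-r) := by positivity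
  have hV : 0 < Real.exp (-(r * (1 - z⁻¹))) + δ / (1 - δ) * Real.exp (-r) := by linarith
  rw [logMgf_eq_log hr hs hV, EReal.coe_le_coe_iff, Real.log_le_iff_le_exp hV, Real.exp_add,
    show r * (z⁻¹ - 1) = -(r * (1 - z⁻¹)) by ring]
  have h4 := Real.add_one_le_exp (δ / (1 - δ) * Real.exp (-r))
  have h5 := mul_le_mul_of_nonneg_left h4 (Real.exp_pos (-(r * (1 - z⁻¹)))).le
  nlinarith

theorem div_one_sub_le {d : ℝ} (h : d ≤ 1 / 2) : d / (1 - d) ≤ d + 2 * d ^ 2 := by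
  rw [div_le_iff₀ (by linarith)]
  nlinarith [sq_nonneg d]

theorem IsHypothesis.level_le_one {ι : Type*} [Fintype ι] {P : ι → ℝ} (hP : IsHypothesis P) {y : ℝ}
    (hy : y ∈ levels P) : y ≤ 1 := by
  obtain ⟨a, -, rfl⟩ := Finset.mem_image.1 hy
  rw [← hP.2]
  exact Finset.single_le_sum (fun b _ => (hP.1 b).le) (Finset.mem_univ a)

/-- At u = 1/2 the weights exp(-κ/2) are slightly damped by z and lowered at 0. To first order in δ
the alternative gains exp(-kx) + k exp(-ky) x, which is strictly convex with minimum at x = y, where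
it equals the cost g(y) under the hypothesis. The excess away from y grows at least like ck(|x - y|
- η), matching the slope α = -δck; what remains is of order δ²(k+1). -/
theorem exists_mergedObjective_neg {ι : Type*} [Fintype ι] {P : ι → ℝ} (hP : IsHypothesis P)
    {k ε : ℝ} (hk : 0 < k) (hε : 0 < ε) :
    ∃ α : ℝ, α ≤ 0 ∧ ∃ κ : ℕ → ℝ → ℝ, mergedObjective P k ε α (1 / 2) κ < 0 := by
  set n : ℝ := ∑ y ∈ levels P, (mult P y : ℝ) with hn
  have hn0 : 0 < n := Finset.sum_pos (fun y hy => Nat.cast_pos.2 (mult_pos hy)) hP.levels_nonempty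
  -- Since nη = ε/2, the loss from η uses up only half of the gain proportional to ε.
  set η := ε / (2 * n) with hη
  have hη0 : 0 < η := by positivity
  have hexp : Real.exp (-(k * η)) < 1 := Real.exp_lt_one_iff.2 (by have := mul_pos hk hη0; linarith)
  set c := Real.exp (-k) * (1 - Real.exp (-(k * η))) with hc
  have hc0 : 0 < c := mul_pos (Real.exp_pos _) (by linarith)
  -- The second bound makes the quadratic error 2nδ²(k+1) at most a quarter of the gain δckε.
  set δ := min (1 / 2) (ε * (c * k) / (8 * n * (k + 1))) with hδ
  have hδ0 : 0 < δ := by positivity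
  have hδ2 : δ ≤ 1 / 2 := min_le_left _ _
  have hδ3 : δ * (8 * n * (k + 1)) ≤ ε * (c * k) := by
    rw [← le_div_iff₀ (by positivity)]; exact min_le_right _ _
  set z : ℝ → ℝ := fun y => 1 - Real.exp (-(k * y)) * δ with hz
  set g : ℝ → ℝ := fun y => k * Real.exp (-(k * y)) * y + Real.exp (-(k * y)) with hg
  have hσ : ∀ y ∈ levels P, Real.exp (-(k * y)) ≤ 1 := fun y hy => Real.exp_le_one_iff.2 (by
    have := mul_pos hk (hP.level_pos hy); linarith)
  have hz0 : ∀ y ∈ levels P, 1 / 2 ≤ z y := fun y hy => by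
    have := hσ y hy; simp only [hz]; nlinarith
  have hz1 : ∀ y ∈ levels P, z y ≤ 1 := fun y hy => by
    have := mul_pos (Real.exp_pos (-(k * y))) hδ0; simp only [hz]; linarith
  refine ⟨-(δ * (c * k)), by have := mul_pos hδ0 (mul_pos hc0 hk); linarith,
    fun i y => -2 * Real.log (dippedWeight (z y) δ i), ?_⟩
  refine (mergedObjective_le (a := fun y => δ * g y + 2 * δ ^ 2 * (k + 1))
    (s := fun y => -(δ * g y) + δ * (c * k) * η) ⟨by norm_num, by norm_num⟩ (fun y hy => ?_)
    fun y hy x => ?_).trans_lt ?_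
  · have hy0 := hP.level_pos hy
    have hy1 := hP.level_le_one hy
    refine (logMgf_dippedWeight_inv_le (by linarith [hz0 y hy]) (hz1 y hy) hδ0.le (by linarith)
      (by positivity)).trans ?_
    rw [EReal.coe_le_coe_iff]
    have h0 := Real.exp_pos (-(k * y))
    have h1 := hσ y hy
    have e1 : (z y)⁻¹ - 1 ≤ Real.exp (-(k * y)) * δ + 2 * δ ^ 2 := by
      have h2 := div_one_sub_le (d := Real.exp (-(k * y)) * δ) (by nlinarith)
      have h3 : (z y)⁻¹ - 1 = Real.exp (-(k * y)) * δ / (1 - Real.exp (-(k * y)) * δ) := by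
        have : z y ≠ 0 := by linarith [hz0 y hy]
        change _ = _ / z y
        field_simp
        simp only [hz]; ring
      rw [h3]
      refine h2.trans ?_
      have : (Real.exp (-(k * y)) * δ) ^ 2 ≤ (1 * δ) ^ 2 := by gcongr
      linarith
    have e2 := div_one_sub_le hδ2
    have e3 := mul_le_mul_of_nonneg_left e1 (by positivity : 0 ≤ k * y)
    have e4 := mul_le_mul_of_nonneg_right e2 h0.le
    have e5 : k * y * (2 * δ ^ 2) ≤ k * 1 * (2 * δ ^ 2) := by gcongr
    have e6 : 2 * δ ^ 2 * Real.exp (-(k * y)) ≤ 2 * δ ^ 2 * 1 := by gcongr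
    simp only [hg]
    linarith
  · have hy0 := hP.level_pos hy
    have hy1 := hP.level_le_one hy
    refine (logMgf_dippedWeight_le (by linarith [hz0 y hy]) (hz1 y hy) hδ0.le (by linarith)
      (by positivity)).trans ?_
    rw [EReal.coe_le_coe_iff]
    have h0 := Real.exp_pos (-(k * y))
    have h1 : Real.exp (-k) ≤ Real.exp (-(k * y)) := Real.exp_le_exp.2 (by nlinarith)
    have h2 := linear_le_exp_neg_sub (b := k * η) (c := 1 - Real.exp (-(k * η))) (by linarith)
      le_rfl (k * (x - y))
    have h3 : 0 ≤ Real.exp (-(k * (x - y))) - 1 + k * (x - y) := by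
      linarith [Real.add_one_le_exp (-(k * ((x : ℝ) - y)))]
    have h4 := mul_le_mul_of_nonneg_left h2 (Real.exp_pos (-k)).le
    have h5 := mul_le_mul_of_nonneg_right h1 h3
    have h6 : Real.exp (-(k * y)) * Real.exp (-(k * (x - y))) = Real.exp (-(k * x)) := by
      rw [← Real.exp_add]; ring_nf
    rw [abs_mul, abs_of_pos hk] at h4
    have h7 : c * (k * |(x : ℝ) - y| - k * η) ≤ Real.exp (-(k * x)) - Real.exp (-(k * y)) +
        Real.exp (-(k * y)) * k * (x - y) := by
      rw [hc, ← h6]; linarith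
    have h8 := mul_le_mul_of_nonneg_left h7 hδ0.le
    simp only [hz, hg]
    linarith
  · rw [← EReal.coe_zero, EReal.coe_lt_coe_iff, mergedValue_eq]
    simp only [mul_add, Finset.sum_add_distrib, mul_neg, Finset.sum_neg_distrib]
    rw [← Finset.sum_mul, ← Finset.sum_mul, ← Finset.sum_mul, ← hn]
    have hnη : n * η = ε / 2 := by rw [hη]; field_simp
    have h1 : δ * (δ * (8 * n * (k + 1))) ≤ δ * (ε * (c * k)) :=
      mul_le_mul_of_nonneg_left hδ3 hδ0.le
    have h2 : 0 < δ * (ε * (c * k)) := by positivity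
    have h3 : n * (δ * (c * k) * η) = δ * (c * k) * (ε / 2) := by rw [← hnη]; ring
    linarith

/-- At u = 0 the logarithms vanish. Testing each supremum at x = y + ε gives at least -αε per domain
element, and one element already offsets the term εα. -/
theorem mergedObjective_zero_nonneg {ι : Type*} [Fintype ι] {P : ι → ℝ} (hP : IsHypothesis P)
    {k ε α : ℝ} (hk : 0 < k) (hε : 0 < ε) (hα : α ≤ 0) (κ : ℕ → ℝ → ℝ) :
    0 ≤ mergedObjective P k ε α 0 κ := by
  have h : ((ε * α * (1 - 0) + ∑ y ∈ levels P, (mult P y : ℝ) * (-α * ε) : ℝ) : EReal) ≤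
      mergedObjective P k ε α 0 κ := by
    rw [mergedObjective, EReal.coe_add, coe_finset_sum]
    refine add_le_add le_rfl (Finset.sum_le_sum fun y hy => ?_)
    rw [zero_mul, EReal.coe_zero, zero_mul, zero_add, sub_zero, one_mul, EReal.coe_mul]
    refine mul_le_mul_of_nonneg_left ?_ (EReal.coe_nonneg.2 (Nat.cast_nonneg _))
    have hy0 := hP.level_pos hy
    refine le_trans ?_ (le_iSup _ (NNReal.mk (y + ε) (by positivity)))
    rw [neg_zero, logMgf_zero_left (by rw [NNReal.coe_mk]; positivity), add_zero,
      EReal.coe_le_coe_iff]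
    simp [abs_of_pos hε]
  refine le_trans ?_ h
  rw [EReal.coe_nonneg, ← Finset.sum_mul]
  have h1 : (1 : ℝ) ≤ ∑ y ∈ levels P, (mult P y : ℝ) := by
    obtain ⟨y, hy⟩ := hP.levels_nonempty
    refine le_trans ?_ (Finset.single_le_sum (fun _ _ => Nat.cast_nonneg _) hy)
    exact_mod_cast mult_pos hy
  have := mul_le_mul_of_nonneg_right h1 (by nlinarith : 0 ≤ -α * ε)
  linarith

theorem mergedObjective_one {ι : Type*} [Fintype ι] {P : ι → ℝ} (hP : IsHypothesis P)
    {k ε α : ℝ} (hk : 0 < k) (κ : ℕ → ℝ → ℝ) : mergedObjective P k ε α 1 κ = 0 := by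
  rw [mergedObjective, sub_self, mul_zero, EReal.coe_zero, zero_add]
  refine Finset.sum_eq_zero fun y hy => ?_
  have := hP.level_pos hy
  rw [logMgf_zero_left (by positivity), mul_zero, zero_mul, EReal.coe_zero, zero_mul, zero_add]

theorem IsOptimal.mergedObjective_neg {ι : Type*} [Fintype ι] {P : ι → ℝ} (hP : IsHypothesis P)
    {k ε : ℝ} (hk : 0 < k) (hε : 0 < ε) {θ : Params} (hθ : IsOptimal P k ε θ) :
    mergedObjective P k ε θ.α θ.u (θ.kappa k) < 0 := by
  obtain ⟨α, hα, κ, h⟩ := exists_mergedObjective_neg hP hk hε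
  exact (hθ.minimal α (1 / 2) hα ⟨by norm_num, by norm_num⟩ κ).trans_lt h

theorem IsOptimal.u_mem_Ioo {ι : Type*} [Fintype ι] {P : ι → ℝ} (hP : IsHypothesis P)
    {k ε : ℝ} (hk : 0 < k) (hε : 0 < ε) {θ : Params} (hθ : IsOptimal P k ε θ) :
    θ.u ∈ Set.Ioo (0 : ℝ) 1 := by
  have h := hθ.mergedObjective_neg hP hk hε
  refine ⟨lt_of_le_of_ne hθ.u_mem.1 fun h0 => ?_, lt_of_le_of_ne hθ.u_mem.2 fun h1 => ?_⟩
  · rw [← h0] at h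
    exact absurd h (not_lt.2 (mergedObjective_zero_nonneg hP hk hε hθ.α_nonpos _))
  · rw [h1, mergedObjective_one hP hk] at h
    exact lt_irrefl _ h

/-! ### The two-point mixtures -/

/-- The constraints on the parameters of one level. -/
structure Params.Admissible (θ : Params) (y : ℝ) : Prop where
  q_mem : θ.q y ∈ Set.Ioo (0 : ℝ) 1
  x₁_nonneg : 0 ≤ θ.x₁ y
  x₁_lt : θ.x₁ y < y
  lt_x₂ : y < θ.x₂ y

theorem IsOptimal.admissible {ι : Type*} [Fintype ι] {P : ι → ℝ} {k ε : ℝ} {θ : Params}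
    (hθ : IsOptimal P k ε θ) {y : ℝ} (hy : y ∈ levels P) : θ.Admissible y :=
  ⟨hθ.q_mem y hy, hθ.x₁_nonneg y hy, hθ.x₁_lt y hy, hθ.lt_x₂ y hy⟩

/-- The two-point mixture of a level. -/
noncomputable def Params.mix (θ : Params) (k y : ℝ) (i : ℕ) : ℝ :=
  θ.q y * poi (k * θ.x₁ y) i + (1 - θ.q y) * poi (k * θ.x₂ y) i

/-- The likelihood ratio of the hypothesis to the mixture, to the power `v`. -/
noncomputable def Params.weight (θ : Params) (k v y : ℝ) (i : ℕ) : ℝ :=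
  (poi (k * y) i / θ.mix k y i) ^ v

namespace Params.Admissible

theorem pos {θ : Params} {y : ℝ} (h : θ.Admissible y) : 0 < y := h.x₁_nonneg.trans_lt h.x₁_lt

theorem x₂_pos {θ : Params} {y : ℝ} (h : θ.Admissible y) : 0 < θ.x₂ y := h.pos.trans h.lt_x₂

theorem coin_pos {θ : Params} {y : ℝ} (h : θ.Admissible y) (b : Bool) : 0 < θ.coin y b := by
  have h1 := h.q_mem.1
  have h2 := h.q_mem.2
  cases b <;> simp [Params.coin] <;> linarith

theorem mass_nonneg {θ : Params} {y : ℝ} (h : θ.Admissible y) (b : Bool) : 0 ≤ θ.mass y b := by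
  have h1 := h.x₁_nonneg
  have h2 := h.x₂_pos
  cases b <;> simp [Params.mass] <;> linarith

theorem mix_pos {θ : Params} {k y : ℝ} (h : θ.Admissible y) (hk : 0 < k) (i : ℕ) :
    0 < θ.mix k y i := by
  have h1 := poi_nonneg (mul_nonneg hk.le h.x₁_nonneg) i
  have h2 := poi_pos (mul_pos hk h.x₂_pos) i
  have h3 := h.q_mem.1
  have h4 : 0 < 1 - θ.q y := by linarith [h.q_mem.2]
  rw [Params.mix]; positivity

theorem ratio_pos {θ : Params} {k y : ℝ} (h : θ.Admissible y) (hk : 0 < k) (i : ℕ) :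
    0 < poi (k * y) i / θ.mix k y i :=
  div_pos (poi_pos (mul_pos hk h.pos) i) (h.mix_pos hk i)

theorem weight_pos {θ : Params} {k v y : ℝ} (h : θ.Admissible y) (hk : 0 < k) (i : ℕ) :
    0 < θ.weight k v y i := Real.rpow_pos_of_pos (h.ratio_pos hk i) v

/-- As x₁ < x₂, the mixture lies between two positive multiples of (k x₂)^i / i!, so its likelihood
ratio is comparable to (y/x₂)^i. -/
theorem exists_geomComparable {θ : Params} {k v y : ℝ} (h : θ.Admissible y) (hk : 0 < k)
    (hv : 0 ≤ v) : ∃ ζ c₁ c₂ : ℝ, GeomComparable (θ.weight k v y) ζ c₁ c₂ := by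
  have hy := h.pos
  have hx₂ := h.x₂_pos
  have hx₁ := h.x₁_nonneg
  have hq : 0 < θ.q y := h.q_mem.1
  have hq' : 0 < 1 - θ.q y := by linarith [h.q_mem.2]
  set C := θ.q y * Real.exp (-(k * θ.x₁ y)) + (1 - θ.q y) * Real.exp (-(k * θ.x₂ y)) with hC
  set c := (1 - θ.q y) * Real.exp (-(k * θ.x₂ y)) with hc
  have hC0 : 0 < C := by positivity
  have hc0 : 0 < c := by positivity
  have hp : ∀ i, poi (k * y) i = Real.exp (-(k * y)) * (y / θ.x₂ y) ^ i *
      ((k * θ.x₂ y) ^ i / (i.factorial : ℝ)) := fun i => by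
    rw [poi, mul_assoc, ← mul_div_assoc, ← mul_pow, mul_div_assoc]
    congr 3; field_simp
  have hup : ∀ i, θ.mix k y i ≤ C * ((k * θ.x₂ y) ^ i / (i.factorial : ℝ)) := fun i => by
    have : (k * θ.x₁ y) ^ i ≤ (k * θ.x₂ y) ^ i := by
      have := h.x₁_lt.trans h.lt_x₂
      gcongr
    rw [Params.mix, hC, add_mul]
    refine add_le_add ?_ (le_of_eq ?_)
    · rw [mul_assoc, poi, mul_div_assoc]; gcongr
    · rw [poi]; ring
  have hlo : ∀ i, c * ((k * θ.x₂ y) ^ i / (i.factorial : ℝ)) ≤ θ.mix k y i := fun i => by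
    have := poi_nonneg (mul_nonneg hk.le h.x₁_nonneg) i
    have e : c * ((k * θ.x₂ y) ^ i / (i.factorial : ℝ)) = (1 - θ.q y) * poi (k * θ.x₂ y) i := by
      rw [hc, poi]; ring
    rw [e, Params.mix]
    have : 0 ≤ θ.q y * poi (k * θ.x₁ y) i := by positivity
    linarith
  refine ⟨(y / θ.x₂ y) ^ v, (Real.exp (-(k * y)) / C) ^ v, (Real.exp (-(k * y)) / c) ^ v,
    by positivity, by positivity, fun i => ?_, fun i => ?_⟩
  · rw [Real.rpow_pow_comm (by positivity), ← Real.mul_rpow (by positivity) (by positivity), Params.weight]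
    refine Real.rpow_le_rpow (by positivity) ?_ hv
    rw [le_div_iff₀ (h.mix_pos hk i), hp]
    calc _ ≤ Real.exp (-(k * y)) / C * (y / θ.x₂ y) ^ i *
          (C * ((k * θ.x₂ y) ^ i / (i.factorial : ℝ))) :=
          mul_le_mul_of_nonneg_left (hup i) (by positivity)
      _ = _ := by field_simp
  · rw [Real.rpow_pow_comm (by positivity), ← Real.mul_rpow (by positivity) (by positivity), Params.weight]
    refine Real.rpow_le_rpow (h.ratio_pos hk i).le ?_ hv
    rw [div_le_iff₀ (h.mix_pos hk i), hp]
    calc _ = Real.exp (-(k * y)) / c * (y / θ.x₂ y) ^ i *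
          (c * ((k * θ.x₂ y) ^ i / (i.factorial : ℝ))) := by field_simp
      _ ≤ _ := mul_le_mul_of_nonneg_left (hlo i) (by positivity)

theorem expGrowth_weight {θ : Params} {k v y : ℝ} (h : θ.Admissible y) (hk : 0 < k)
    (hv : 0 ≤ v) : ExpGrowth (θ.weight k v y) := by
  obtain ⟨ζ, c₁, c₂, H⟩ := h.exists_geomComparable hk hv
  exact H.expGrowth

theorem poissonMean_pos {θ : Params} {k v y x : ℝ} (h : θ.Admissible y) (hk : 0 < k)
    (hv : 0 ≤ v) (hx : 0 ≤ x) : 0 < poissonMean k (θ.weight k v y) x := by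
  obtain ⟨ζ, c₁, c₂, H⟩ := h.exists_geomComparable hk hv
  exact H.poissonMean_pos (mul_nonneg hk.le hx)

theorem tilted_eq {θ : Params} {k y : ℝ} (h : θ.Admissible y) (hk : 0 < k) (v : ℝ) (b : Bool) :
    tilted k θ v y b = θ.coin y b * poissonMean k (θ.weight k v y) (θ.mass y b) := by
  rw [tilted, poissonMean, ← tsum_mul_left]
  refine tsum_congr fun i => ?_
  have h1 := h.mix_pos hk i
  have h2 := poi_pos (mul_pos hk h.pos) i
  rw [Params.weight, Real.div_rpow h2.le h1.le, Params.mix]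
  ring

theorem tilted_pos {θ : Params} {k v y : ℝ} (h : θ.Admissible y) (hk : 0 < k) (hv : 0 ≤ v)
    (b : Bool) : 0 < tilted k θ v y b := by
  rw [h.tilted_eq hk]
  exact mul_pos (h.coin_pos b) (h.poissonMean_pos hk hv (h.mass_nonneg b))

theorem sum_tilted_pos {θ : Params} {k v y : ℝ} (h : θ.Admissible y) (hk : 0 < k) (hv : 0 ≤ v) :
    0 < ∑ b, tilted k θ v y b :=
  Finset.sum_pos (fun b _ => h.tilted_pos hk hv b) Finset.univ_nonempty

theorem sum_tilted_eq {θ : Params} {k y : ℝ} (h : θ.Admissible y) (hk : 0 < k) (v : ℝ) :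
    ∑ b, tilted k θ v y b = θ.q y * poissonMean k (θ.weight k v y) (θ.x₁ y) +
      (1 - θ.q y) * poissonMean k (θ.weight k v y) (θ.x₂ y) := by
  rw [Fintype.sum_bool, h.tilted_eq hk, h.tilted_eq hk]
  simp [Params.coin, Params.mass]

theorem hasSum_weight_mul_mix {θ : Params} {k v y : ℝ} (h : θ.Admissible y) (hk : 0 < k)
    (hv : 0 ≤ v) : HasSum (fun i => θ.weight k v y i * θ.mix k y i) (∑ b, tilted k θ v y b) := by
  rw [h.sum_tilted_eq hk]
  have := hasSum_mixture_mul (k := k) (w := θ.weight k v y) (f := fun _ => 1)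
    (M := θ.mix k y) (fun i => rfl) (by simpa using h.expGrowth_weight hk hv)
  simpa using this

theorem exp_neg_mul_kappa {θ : Params} {k y : ℝ} (h : θ.Admissible y) (hk : 0 < k) (v : ℝ) (i : ℕ) :
    Real.exp (-v * θ.kappa k i y) = θ.weight k v y i := by
  have h1 := h.ratio_pos hk i
  rw [Params.weight, Real.rpow_def_of_pos h1, Params.kappa, ← Params.mix, ← inv_div (poi _ _),
    Real.log_inv]
  ring_nf

theorem exp_one_sub_mul_kappa {θ : Params} {k y : ℝ} (h : θ.Admissible y) (hk : 0 < k) (v : ℝ)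
    (i : ℕ) : Real.exp ((1 - v) * θ.kappa k i y) * poi (k * y) i =
      θ.weight k v y i * θ.mix k y i := by
  rw [← h.exp_neg_mul_kappa hk, show (1 - v) * θ.kappa k i y = -v * θ.kappa k i y + θ.kappa k i y by
    ring, Real.exp_add, mul_assoc]
  congr 1
  have h1 := h.mix_pos hk i
  have h2 := poi_pos (mul_pos hk h.pos) i
  rw [Params.kappa, ← Params.mix, Real.exp_log (div_pos h1 h2)]
  field_simp

theorem logMgf_one_sub_kappa {θ : Params} {k v y t : ℝ} {c : ℕ → ℝ} (h : θ.Admissible y)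
    (hk : 0 < k) (hv : 0 ≤ v) (hc : ∀ i, t * c i = (1 - v) * θ.kappa k i y) :
    logMgf t c (k * y) = (Real.log (∑ b, tilted k θ v y b) : EReal) := by
  refine logMgf_eq_log (mul_pos hk h.pos).le ?_ (h.sum_tilted_pos hk hv)
  simp only [hc, h.exp_one_sub_mul_kappa hk]
  exact h.hasSum_weight_mul_mix hk hv

theorem logMgf_neg_kappa {θ : Params} {k v y t x : ℝ} {c : ℕ → ℝ} (h : θ.Admissible y)
    (hk : 0 < k) (hv : 0 ≤ v) (hx : 0 ≤ x) (hc : ∀ i, t * c i = -v * θ.kappa k i y) :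
    logMgf t c (k * x) = (Real.log (poissonMean k (θ.weight k v y) x) : EReal) := by
  refine logMgf_eq_log (mul_nonneg hk.le hx) ?_ (h.poissonMean_pos hk hv hx)
  simp only [hc, h.exp_neg_mul_kappa hk]
  exact ((h.expGrowth_weight hk hv).summable _).hasSum

end Params.Admissible

/-! ### First order conditions at the optimum -/

/-- `S` records the suprema in the merged objective at `θ`. -/
structure IsSupValue {ι : Type*} [Fintype ι] (P : ι → ℝ) (k ε : ℝ) (θ : Params) (S : ℝ → ℝ) :
    Prop where
  bound : ∀ y ∈ levels P, ∀ x, 0 ≤ x →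
    -θ.α * |x - y| + Real.log (poissonMean k (θ.weight k θ.u y) x) ≤ S y
  value : mergedObjective P k ε θ.α θ.u (θ.kappa k) =
    (mergedValue P ε θ.α θ.u (fun y => Real.log (∑ b, tilted k θ θ.u y b)) S : EReal)

theorem IsOptimal.exists_isSupValue {ι : Type*} [Fintype ι] {P : ι → ℝ} (hP : IsHypothesis P)
    {k ε : ℝ} (hk : 0 < k) (hε : 0 < ε) {θ : Params} (hθ : IsOptimal P k ε θ) :
    ∃ S, IsSupValue P k ε θ S := by
  have hu := hθ.u_mem_Ioo hP hk hε
  obtain ⟨S, h1, h2⟩ := exists_mergedObjective_eq (P := P) (ε := ε) (κ := θ.kappa k) hu.2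
    (fun y hy => (hθ.admissible hy).logMgf_one_sub_kappa hk hu.1.le fun i => rfl)
    ((hθ.mergedObjective_neg hP hk hε).trans EReal.zero_lt_top)
  refine ⟨S, fun y hy x hx => ?_, h2⟩
  have h3 := h1 y hy ⟨x, hx⟩
  rw [(hθ.admissible hy).logMgf_neg_kappa hk hu.1.le (by exact hx) (fun i => rfl),
    EReal.coe_le_coe_iff] at h3
  change _ ≤ S y + θ.α * |x - y| at h3
  change Real.log (poissonMean k (θ.weight k θ.u y) x) ≤ _ at h3
  linarith

theorem IsSupValue.logMgf_le {ι : Type*} [Fintype ι] {P : ι → ℝ} {k ε : ℝ} (hk : 0 < k)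
    {θ : Params} (hθ : IsOptimal P k ε θ) {S : ℝ → ℝ} (hS : IsSupValue P k ε θ S) {y t : ℝ}
    {c : ℕ → ℝ} (hy : y ∈ levels P) (hc : ∀ i, t * c i = -θ.u * θ.kappa k i y) (x : ℝ≥0) :
    logMgf t c (k * x) ≤ ((S y + θ.α * |(x : ℝ) - y| : ℝ) : EReal) := by
  rw [(hθ.admissible hy).logMgf_neg_kappa hk hθ.u_mem.1 x.coe_nonneg hc, EReal.coe_le_coe_iff]
  have := hS.bound y hy x x.coe_nonneg
  linarith

/-- Replace κ by dκ and u by u/d with d = 1 - v + u. The product uκ, hence every supremum, is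
unchanged, while (1 - u/d)d = 1 - v turns the first logarithm into log Z_y(v). Minimality compares
the two values. -/
theorem IsSupValue.le_sum_log_tilted {ι : Type*} [Fintype ι] {P : ι → ℝ} (hP : IsHypothesis P)
    {k ε : ℝ} (hk : 0 < k) (hε : 0 < ε) {θ : Params} (hθ : IsOptimal P k ε θ) {S : ℝ → ℝ}
    (hS : IsSupValue P k ε θ S) {A B : ℝ}
    (hA : A = ∑ y ∈ levels P, (mult P y : ℝ) * Real.log (∑ b, tilted k θ θ.u y b))
    (hB : B = ε * θ.α + ∑ y ∈ levels P, (mult P y : ℝ) * S y) {v : ℝ}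
    (hv : v ∈ Set.Icc (0 : ℝ) 1) :
    (1 - v) * (A - B) + (θ.u * A + (1 - θ.u) * B) ≤
      ∑ y ∈ levels P, (mult P y : ℝ) * Real.log (∑ b, tilted k θ v y b) := by
  have hu := hθ.u_mem_Ioo hP hk hε
  set d := 1 - v + θ.u with hd
  have hd0 : 0 < d := by linarith [hu.1, hv.2]
  have h1 := hθ.minimal θ.α (θ.u / d) hθ.α_nonpos ⟨by have := hu.1; positivity, by
    rw [div_le_one hd0]; linarith [hv.2]⟩ (fun i y => d * θ.kappa k i y)
  rw [hS.value] at h1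
  have h2 := h1.trans (mergedObjective_le
    (a := fun y => Real.log (∑ b, tilted k θ v y b)) (s := S)
    ⟨by have := hu.1; positivity, by rw [div_le_one hd0]; linarith [hv.2]⟩
    (fun y hy => ((hθ.admissible hy).logMgf_one_sub_kappa hk hv.1 fun i => by
      rw [← mul_assoc]; congr 1; rw [hd]; rw [hd] at hd0; field_simp; ring).le)
    (fun y hy x => hS.logMgf_le hk hθ hy (fun i => by field_simp) x))
  rw [EReal.coe_le_coe_iff, mergedValue_eq, mergedValue_eq, ← hA, ← hB] at h2
  set a := ∑ y ∈ levels P, (mult P y : ℝ) * Real.log (∑ b, tilted k θ v y b)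
  have h3 : d * (θ.u / d * a + (1 - θ.u / d) * B) = θ.u * a + (1 - v) * B := by
    rw [hd] at hd0 ⊢; field_simp; ring
  have h4 := mul_le_mul_of_nonneg_left h2 hd0.le
  rw [h3, hd] at h4
  have h5 : θ.u * ((1 - v) * (A - B) + (θ.u * A + (1 - θ.u) * B)) ≤ θ.u * a := by linarith
  exact le_of_mul_le_mul_left h5 hu.1

/-- The mean of `f` under the tilted coin of a level. -/
noncomputable def tiltedMean (k : ℝ) (θ : Params) (v y : ℝ) (f : ℝ → ℝ) : ℝ :=
  (∑ b, tilted k θ v y b * f (θ.mass y b)) / ∑ b, tilted k θ v y b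

/-- Replace α by α - τ and perturb the weights of all levels along their targets. The objective
changes by at most (1-u)τ(-ε + ∑ N_y · mean of the target + 2nη), which minimality forces to be
nonnegative. -/
theorem IsSupValue.le_sum_slackTarget {ι : Type*} [Fintype ι] {P : ι → ℝ} (hP : IsHypothesis P)
    {k ε : ℝ} (hk : 0 < k) (hε : 0 < ε) {θ : Params} (hθ : IsOptimal P k ε θ) {S : ℝ → ℝ}
    (hS : IsSupValue P k ε θ S) {L : ℝ} (hL : 0 ≤ L) :
    ε ≤ ∑ y ∈ levels P, (mult P y : ℝ) *
      tiltedMean k θ θ.u y (slackTarget k y (-θ.α) (S y) L (θ.weight k θ.u y)) := by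
  have hu := hθ.u_mem_Ioo hP hk hε
  have hu0 := hu.1
  have hu1 : 0 < 1 - θ.u := by linarith [hu.2]
  set e : ℝ → ℝ := fun y =>
    tiltedMean k θ θ.u y (slackTarget k y (-θ.α) (S y) L (θ.weight k θ.u y)) with he
  set n : ℝ := ∑ y ∈ levels P, (mult P y : ℝ) with hn
  have hn0 : 0 < n := Finset.sum_pos (fun y hy => Nat.cast_pos.2 (mult_pos hy)) hP.levels_nonempty
  suffices h : ∀ η, 0 < η → ε ≤ ∑ y ∈ levels P, (mult P y : ℝ) * e y + 2 * n * η by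
    refine le_of_forall_pos_le_add fun r hr => ?_
    have := h (r / (2 * n)) (by positivity)
    rwa [mul_div_cancel₀ _ (by positivity)] at this
  intro η hη
  have key : ∀ y ∈ levels P, ∃ τ₀, 0 < τ₀ ∧ ∀ τ, 0 < τ → τ ≤ τ₀ → ∃ w' : ℕ → ℝ,
      (∀ i, 0 < w' i) ∧ (∀ x, 0 ≤ x → Summable (fun i => w' i * poi (k * x) i) ∧
        (-θ.α + τ) * |x - y| + Real.log (poissonMean k w' x) ≤ S y + η * τ) ∧
      Summable (fun i => θ.weight k θ.u y i * θ.mix k y i *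
        (w' i / θ.weight k θ.u y i) ^ (-((1 - θ.u) / θ.u))) ∧
      ∑' i, θ.weight k θ.u y i * θ.mix k y i *
        (w' i / θ.weight k θ.u y i) ^ (-((1 - θ.u) / θ.u)) ≤
        (∑ b, tilted k θ θ.u y b) * Real.exp ((1 - θ.u) / θ.u * τ * (e y + η)) := by
    intro y hy
    have h := hθ.admissible hy
    obtain ⟨ζ, c₁, c₂, H⟩ := h.exists_geomComparable hk hu0.le
    refine H.exists_perturbation hk h.pos.le (hS.bound y hy) h.x₁_nonneg (h.x₁_lt.trans h.lt_x₂)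
      h.q_mem.1 (by linarith [h.q_mem.2]) (fun i => rfl) hL hη (by positivity)
      (h.sum_tilted_eq hk θ.u) ?_
    have hZ := h.sum_tilted_pos hk hu0.le
    rw [he]
    simp only [tiltedMean]
    rw [mul_div_cancel₀ _ hZ.ne', Fintype.sum_bool, h.tilted_eq hk, h.tilted_eq hk]
    simp [Params.coin, Params.mass, mul_assoc]
  choose! τ₀ hτ₀ hτw using key
  obtain ⟨τ, hτ, hττ⟩ : ∃ τ, 0 < τ ∧ ∀ y ∈ levels P, τ ≤ τ₀ y :=
    ⟨(levels P).inf' hP.levels_nonempty τ₀,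
      (Finset.lt_inf'_iff _).2 hτ₀, fun y hy => Finset.inf'_le _ hy⟩
  have key : ∀ y ∈ levels P, _ := fun y hy => hτw y hy τ hτ (hττ y hy)
  choose! w' hpos hx hsum hle using key
  -- These coefficients satisfy exp(-uκ) = w'; accordingly exp((1-u)κ) is w' to the power -(1-u)/u,
  -- the exponent used in the moment bound.
  have h1 := hθ.minimal (θ.α - τ) θ.u (by linarith [hθ.α_nonpos]) hθ.u_mem
    (fun i y => -(1 / θ.u) * Real.log (w' y i))
  rw [hS.value] at h1
  have h2 := h1.trans (mergedObjective_le
    (a := fun y => Real.log (∑ b, tilted k θ θ.u y b) + (1 - θ.u) / θ.u * τ * (e y + η))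
    (s := fun y => S y + η * τ) hθ.u_mem (fun y hy => ?_) (fun y hy x => ?_))
  · rw [EReal.coe_le_coe_iff, mergedValue_eq, mergedValue_eq] at h2
    simp only [mul_add, Finset.sum_add_distrib] at h2
    have e1 : ∑ y ∈ levels P, (mult P y : ℝ) * ((1 - θ.u) / θ.u * τ * e y) =
        (1 - θ.u) / θ.u * τ * ∑ y ∈ levels P, (mult P y : ℝ) * e y := by
      rw [Finset.mul_sum]; exact Finset.sum_congr rfl fun y _ => by ring
    have e2 : θ.u * ((1 - θ.u) / θ.u) = 1 - θ.u := by field_simp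
    rw [e1, ← Finset.sum_mul, ← Finset.sum_mul, ← hn] at h2
    set E := ∑ y ∈ levels P, (mult P y : ℝ) * e y
    have h3 : 0 ≤ (1 - θ.u) * τ * (E + 2 * n * η - ε) := by
      linear_combination h2 + (τ * E + τ * n * η) * e2
    have h4 := nonneg_of_mul_nonneg_right h3 (mul_pos hu1 hτ)
    linarith
  · have h := hθ.admissible hy
    have hterm : ∀ i, Real.exp ((1 - θ.u) * (-(1 / θ.u) * Real.log (w' y i))) * poi (k * y) i =
        θ.weight k θ.u y i * θ.mix k y i *
          (w' y i / θ.weight k θ.u y i) ^ (-((1 - θ.u) / θ.u)) := by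
      intro i
      have hw := h.weight_pos (v := θ.u) hk i
      have e3 : θ.weight k θ.u y i ^ (-((1 - θ.u) / θ.u)) =
          Real.exp ((1 - θ.u) * θ.kappa k i y) := by
        rw [← h.exp_neg_mul_kappa hk θ.u, ← Real.exp_mul]
        congr 1; field_simp
      rw [Real.div_rpow (hpos y hy i).le hw.le, e3, ← h.exp_one_sub_mul_kappa hk θ.u i,
        Real.rpow_def_of_pos (hpos y hy i)]
      field_simp
    have hs : HasSum (fun i => Real.exp ((1 - θ.u) * (-(1 / θ.u) * Real.log (w' y i))) *
        poi (k * y) i) _ := (hsum y hy).hasSum.congr_fun hterm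
    have hV : 0 < ∑' i, θ.weight k θ.u y i * θ.mix k y i *
        (w' y i / θ.weight k θ.u y i) ^ (-((1 - θ.u) / θ.u)) :=
      (hsum y hy).tsum_pos (fun i => by
        rw [← hterm]; exact mul_nonneg (Real.exp_pos _).le (poi_nonneg (mul_pos hk h.pos).le i)) 0
        (by rw [← hterm]; exact mul_pos (Real.exp_pos _) (poi_pos (mul_pos hk h.pos) 0))
    rw [logMgf_eq_log (mul_pos hk h.pos).le hs hV, EReal.coe_le_coe_iff]
    have h3 := Real.log_le_log hV (hle y hy)
    rwa [Real.log_mul (h.sum_tilted_pos hk hu0.le).ne' (Real.exp_pos _).ne', Real.log_exp] at h3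
  · obtain ⟨hs, hb⟩ := hx y hy x x.coe_nonneg
    have hkx : 0 ≤ k * (x : ℝ) := mul_nonneg hk.le x.coe_nonneg
    have hs' : HasSum (fun i => Real.exp (-θ.u * (-(1 / θ.u) * Real.log (w' y i))) *
        poi (k * x) i) (poissonMean k (w' y) x) := by
      refine hs.hasSum.congr_fun fun i => ?_
      rw [show -θ.u * (-(1 / θ.u) * Real.log (w' y i)) = Real.log (w' y i) by field_simp,
        Real.exp_log (hpos y hy i)]
    have hV : 0 < poissonMean k (w' y) x :=
      hs.tsum_pos (fun i => mul_nonneg (hpos y hy i).le (poi_nonneg hkx i)) 0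
        (mul_pos (hpos y hy 0) (by rw [poi_zero_right]; exact Real.exp_pos _))
    rw [logMgf_eq_log hkx hs' hV, EReal.coe_le_coe_iff]
    linarith

/-- Both outcomes of a coin attain the supremum of their level, and the tilted coins have mean
distance at least `ε`. -/
theorem IsSupValue.attained {ι : Type*} [Fintype ι] {P : ι → ℝ} (hP : IsHypothesis P)
    {k ε : ℝ} (hk : 0 < k) (hε : 0 < ε) {θ : Params} (hθ : IsOptimal P k ε θ) {S : ℝ → ℝ}
    (hS : IsSupValue P k ε θ S) :
    (∀ y ∈ levels P, ∀ b, poissonMean k (θ.weight k θ.u y) (θ.mass y b) =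
      Real.exp (S y + θ.α * |θ.mass y b - y|)) ∧
    ε ≤ ∑ y ∈ levels P, (mult P y : ℝ) * tiltedMean k θ θ.u y (fun x => |x - y|) := by
  set slack : ℝ → ℝ → ℝ := fun y x =>
    S y - -θ.α * |x - y| - Real.log (poissonMean k (θ.weight k θ.u y) x) with hslack
  have hu0 := hθ.u_mem.1
  set D := ∑ y ∈ levels P, (mult P y : ℝ) * tiltedMean k θ θ.u y (fun x => |x - y|) with hD
  set E := ∑ y ∈ levels P, (mult P y : ℝ) * tiltedMean k θ θ.u y (slack y) with hE
  -- Here E ≥ 0 is the mean total slack. Validity for arbitrarily large L forces E = 0, which is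
  -- complementary slackness; L = 0 gives the mean distance.
  have key : ∀ L, 0 ≤ L → ε ≤ D - L * E := by
    intro L hL
    refine (hS.le_sum_slackTarget hP hk hε hθ hL).trans_eq ?_
    rw [hD, hE, Finset.mul_sum, ← Finset.sum_sub_distrib]
    refine Finset.sum_congr rfl fun y _ => ?_
    simp only [tiltedMean, slackTarget, Fintype.sum_bool, hslack]
    ring
  have hsl : ∀ y ∈ levels P, ∀ b, 0 ≤ slack y (θ.mass y b) := fun y hy b => by
    have := hS.bound y hy _ ((hθ.admissible hy).mass_nonneg b)
    simp only [hslack]; linarith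
  have hterm : ∀ y ∈ levels P, 0 ≤ (mult P y : ℝ) * tiltedMean k θ θ.u y (slack y) :=
    fun y hy => mul_nonneg (Nat.cast_nonneg _) (div_nonneg (Finset.sum_nonneg fun b _ =>
      mul_nonneg ((hθ.admissible hy).tilted_pos hk hu0 b).le (hsl y hy b))
      ((hθ.admissible hy).sum_tilted_pos hk hu0).le)
  have hE0 : E = 0 := by
    refine le_antisymm (not_lt.1 fun hpos => ?_) (Finset.sum_nonneg hterm)
    have h1 := key (|D| / E) (by positivity)
    rw [div_mul_cancel₀ _ hpos.ne'] at h1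
    linarith [le_abs_self D]
  refine ⟨fun y hy b => ?_, by simpa using key 0 le_rfl⟩
  have h := hθ.admissible hy
  have h1 := (Finset.sum_eq_zero_iff_of_nonneg hterm).1 hE0 y hy
  have hm : (mult P y : ℝ) ≠ 0 := Nat.cast_ne_zero.2 (mult_pos hy).ne'
  have h2 : ∑ b, tilted k θ θ.u y b * slack y (θ.mass y b) = 0 := by
    rcases div_eq_zero_iff.1 ((mul_eq_zero.1 h1).resolve_left hm) with h3 | h3
    · exact h3
    · exact absurd h3 (h.sum_tilted_pos hk hu0).ne'
  have h3 := (Finset.sum_eq_zero_iff_of_nonneg fun b _ =>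
    mul_nonneg (h.tilted_pos hk hu0 b).le (hsl y hy b)).1 h2 b (Finset.mem_univ b)
  have h4 := (mul_eq_zero.1 h3).resolve_left (h.tilted_pos hk hu0 b).ne'
  rw [← Real.exp_log (h.poissonMean_pos hk hu0 (h.mass_nonneg b))]
  congr 1
  simp only [hslack] at h4
  linarith

/-! ### The Chernoff bound on the tilted coins -/

/-- The unnormalized moment generating function of the distance under the tilted coin. -/
noncomputable def tiltedMgf (k : ℝ) (θ : Params) (v y s : ℝ) : ℝ :=
  ∑ b : Bool, Real.exp (s * |θ.mass y b - y|) * tilted k θ v y b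

namespace Params.Admissible

theorem tiltedMgf_pos {θ : Params} {k v y : ℝ} (h : θ.Admissible y) (hk : 0 < k) (hv : 0 ≤ v)
    (s : ℝ) : 0 < tiltedMgf k θ v y s :=
  Finset.sum_pos (fun b _ => mul_pos (Real.exp_pos _) (h.tilted_pos hk hv b)) Finset.univ_nonempty

/-- The tangent line bound on the logarithm of the moment generating function. -/
theorem log_tiltedMgf_ge {θ : Params} {k v y : ℝ} (h : θ.Admissible y) (hk : 0 < k) (hv : 0 ≤ v)
    (s : ℝ) : Real.log (∑ b, tilted k θ v y b) + s * tiltedMean k θ v y (fun x => |x - y|) ≤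
      Real.log (tiltedMgf k θ v y s) := by
  have hZ := h.sum_tilted_pos hk hv
  set m := tiltedMean k θ v y (fun x => |x - y|) with hm
  have hmZ : m * ∑ b, tilted k θ v y b = ∑ b, tilted k θ v y b * |θ.mass y b - y| := by
    rw [hm, tiltedMean, div_mul_cancel₀ _ hZ.ne']
  rw [Real.le_log_iff_exp_le (h.tiltedMgf_pos hk hv s), Real.exp_add, Real.exp_log hZ]
  -- The added linear term sums to zero because m is the tilted mean, and then 1 + x ≤ exp x applies
  -- to each outcome.
  calc _ = ∑ b, Real.exp (s * m) * (tilted k θ v y b * (1 + s * (|θ.mass y b - y| - m))) := by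
        rw [← Finset.mul_sum, mul_comm]
        congr 1
        simp only [Fintype.sum_bool] at hmZ ⊢
        linear_combination s * hmZ
    _ ≤ _ := by
        refine Finset.sum_le_sum fun b _ => ?_
        have h1 := Real.add_one_le_exp (s * (|θ.mass y b - y| - m))
        have h2 := h.tilted_pos hk hv b
        calc _ ≤ Real.exp (s * m) *
              (tilted k θ v y b * Real.exp (s * (|θ.mass y b - y| - m))) := by
              gcongr; linarith
          _ = _ := by
              rw [mul_left_comm, ← Real.exp_add, mul_comm]
              congr 2; ring

/-- The weight is log-linear in its exponent, so this is weighted AM-GM. With X and Y taken as the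
total masses, summation gives Hölder's inequality. -/
theorem weight_interpolate_le {θ : Params} {k u v l c X Y y : ℝ} (h : θ.Admissible y)
    (hk : 0 < k) (hl0 : 0 ≤ l) (hl1 : l ≤ 1) (hX : 0 < X) (hY : 0 < Y) (hc : 0 < c) (i : ℕ) :
    c ^ l * θ.weight k ((1 - l) * u + l * v) y i ≤
      X ^ (1 - l) * Y ^ l * ((1 - l) * (θ.weight k u y i / X) + l * (c * θ.weight k v y i / Y)) := by
  have hr := h.ratio_pos hk i
  have hu := h.weight_pos (v := u) hk i
  have hv := h.weight_pos (v := v) hk i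
  have h1 := Real.geom_mean_le_arith_mean2_weighted (sub_nonneg.2 hl1) hl0
    (div_pos hu hX).le (div_pos (mul_pos hc hv) hY).le (by ring)
  have h2 : θ.weight k ((1 - l) * u + l * v) y i =
      θ.weight k u y i ^ (1 - l) * θ.weight k v y i ^ l := by
    simp only [Params.weight]
    rw [← Real.rpow_mul hr.le, ← Real.rpow_mul hr.le, ← Real.rpow_add hr]
    ring_nf
  rw [Real.div_rpow hu.le hX.le, Real.div_rpow (mul_pos hc hv).le hY.le,
    Real.mul_rpow hc.le hv.le] at h1
  refine le_trans (le_of_eq ?_) (mul_le_mul_of_nonneg_left h1 (by positivity))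
  rw [h2]
  have hX' : X ^ (1 - l) ≠ 0 := (Real.rpow_pos_of_pos hX _).ne'
  have hY' : Y ^ l ≠ 0 := (Real.rpow_pos_of_pos hY _).ne'
  field_simp

/-- Joint convexity of the logarithm of the moment generating function in the two exponents. -/
theorem log_tiltedMgf_interpolate_le {θ : Params} {k u v l s y : ℝ} (h : θ.Admissible y)
    (hk : 0 < k) (hu : 0 ≤ u) (hv : 0 ≤ v) (hl0 : 0 ≤ l) (hl1 : l ≤ 1) :
    Real.log (tiltedMgf k θ ((1 - l) * u + l * v) y (l * s)) ≤
      (1 - l) * Real.log (∑ b, tilted k θ u y b) + l * Real.log (tiltedMgf k θ v y s) := by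
  set X := ∑ b, tilted k θ u y b with hX
  set Y := tiltedMgf k θ v y s with hY
  have hX0 : 0 < X := h.sum_tilted_pos hk hu
  have hY0 : 0 < Y := h.tiltedMgf_pos hk hv s
  have hvl : 0 ≤ (1 - l) * u + l * v :=
    add_nonneg (mul_nonneg (by linarith) hu) (mul_nonneg hl0 hv)
  have hb : ∀ b, Real.exp (l * s * |θ.mass y b - y|) * tilted k θ ((1 - l) * u + l * v) y b ≤
      X ^ (1 - l) * Y ^ l * ((1 - l) * (tilted k θ u y b / X) +
        l * (Real.exp (s * |θ.mass y b - y|) * tilted k θ v y b / Y)) := by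
    intro b
    set x := θ.mass y b
    set c := Real.exp (s * |x - y|) with hc
    have hc0 : 0 < c := Real.exp_pos _
    have hcl : Real.exp (l * s * |x - y|) = c ^ l := by
      rw [hc, ← Real.exp_mul]; ring_nf
    have hx : 0 ≤ k * x := mul_nonneg hk.le (h.mass_nonneg b)
    have s1 := ((h.expGrowth_weight hk hvl).summable (k * x)).hasSum.mul_left (c ^ l)
    have s2 := ((((h.expGrowth_weight hk hu).summable (k * x)).hasSum.mul_left ((1 - l) / X)).add
      (((h.expGrowth_weight hk hv).summable (k * x)).hasSum.mul_left (l * c / Y))).mul_left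
      (X ^ (1 - l) * Y ^ l)
    have h1 := hasSum_le (fun i => ?_) s1 s2
    · rw [h.tilted_eq hk, h.tilted_eq hk, h.tilted_eq hk, hcl]
      simp only [poissonMean]
      have := mul_le_mul_of_nonneg_left h1 (h.coin_pos b).le
      refine le_trans (le_of_eq (by ring)) (this.trans (le_of_eq (by ring)))
    · have := mul_le_mul_of_nonneg_right
        (h.weight_interpolate_le (u := u) (v := v) hk hl0 hl1 hX0 hY0 hc0 i) (poi_nonneg hx i)
      refine le_trans (le_of_eq (by ring)) (this.trans (le_of_eq (by ring)))
  have hsum : tiltedMgf k θ ((1 - l) * u + l * v) y (l * s) ≤ X ^ (1 - l) * Y ^ l := by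
    refine (Finset.sum_le_sum fun b _ => hb b).trans_eq ?_
    rw [← Finset.mul_sum, Finset.sum_add_distrib, ← Finset.mul_sum, ← Finset.mul_sum,
      ← Finset.sum_div, ← Finset.sum_div, ← hX]
    change X ^ (1 - l) * Y ^ l * ((1 - l) * (X / X) + l * (Y / Y)) = _
    rw [div_self hX0.ne', div_self hY0.ne']; ring
  have h2 := Real.log_le_log (h.tiltedMgf_pos hk hvl _) hsum
  rwa [Real.log_mul (Real.rpow_pos_of_pos hX0 _).ne' (Real.rpow_pos_of_pos hY0 _).ne',
    Real.log_rpow hX0, Real.log_rpow hY0] at h2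

theorem continuousOn_tilted {θ : Params} {k y : ℝ} (h : θ.Admissible y) (hk : 0 < k) (b : Bool) :
    ContinuousOn (fun v => tilted k θ v y b) (Set.Icc 0 1) := by
  simp only [h.tilted_eq hk]
  refine ContinuousOn.mul continuousOn_const ?_
  have hx : 0 ≤ k * θ.mass y b := mul_nonneg hk.le (h.mass_nonneg b)
  -- For v in [0, 1] a positive r satisfies r^v ≤ 1 + r, which gives a summable majorant independent
  -- of v.
  refine continuousOn_tsum (u := fun i => (1 + θ.weight k 1 y i) * poi (k * θ.mass y b) i)
    (fun i => ?_) (((ExpGrowth.const 1).add (h.expGrowth_weight hk zero_le_one)).summable _)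
    fun i v hv => ?_
  · simp only [Params.weight]
    exact ((Real.continuous_const_rpow (h.ratio_pos hk i).ne').mul continuous_const).continuousOn
  · have hr := h.ratio_pos hk i
    have hp := poi_nonneg hx i
    rw [Real.norm_eq_abs, abs_of_nonneg (mul_nonneg (h.weight_pos hk i).le hp)]
    refine mul_le_mul_of_nonneg_right ?_ hp
    simp only [Params.weight, Real.rpow_one]
    rcases le_total (poi (k * y) i / θ.mix k y i) 1 with h1 | h1
    · linarith [Real.rpow_le_one hr.le h1 hv.1]
    · have := Real.rpow_le_rpow_of_exponent_le h1 hv.2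
      rw [Real.rpow_one] at this
      linarith

theorem continuousOn_tiltedMean {θ : Params} {k y : ℝ} (h : θ.Admissible y) (hk : 0 < k)
    (f : ℝ → ℝ) : ContinuousOn (fun v => tiltedMean k θ v y f) (Set.Icc 0 1) := by
  simp only [tiltedMean]
  refine ContinuousOn.div ?_ ?_ fun v hv => (h.sum_tilted_pos hk hv.1).ne'
  · exact continuousOn_finsetSum _ fun b _ => (h.continuousOn_tilted hk b).mul continuousOn_const
  · exact continuousOn_finsetSum _ fun b _ => h.continuousOn_tilted hk b

end Params.Admissible

/-- On the segment from (u, 0) to (v, s), the point with parameter l has first exponent v_l and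
second exponent ls. The rescaling bound at v_l and the tangent line in s bound its log moment
generating function below; convexity bounds it above by the endpoints. The terms (1-l)A cancel
exactly, and after division by l the limit l → 0 brings in the mean distance at u, which is at least
ε. -/
theorem IsSupValue.le_log_tiltedMgf {ι : Type*} [Fintype ι] {P : ι → ℝ} (hP : IsHypothesis P)
    {k ε : ℝ} (hk : 0 < k) (hε : 0 < ε) {θ : Params} (hθ : IsOptimal P k ε θ) {S : ℝ → ℝ}
    (hS : IsSupValue P k ε θ S) {A B : ℝ}
    (hA : A = ∑ y ∈ levels P, (mult P y : ℝ) * Real.log (∑ b, tilted k θ θ.u y b))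
    (hB : B = ε * θ.α + ∑ y ∈ levels P, (mult P y : ℝ) * S y) {v s : ℝ}
    (hv : v ∈ Set.Icc (0 : ℝ) 1) (hs : 0 ≤ s) :
    (1 - v) * (A - B) + (θ.u * A + (1 - θ.u) * B) ≤
      -s * ε + ∑ y ∈ levels P, (mult P y : ℝ) * Real.log (tiltedMgf k θ v y s) := by
  have hu := hθ.u_mem
  set D : ℝ → ℝ := fun v' =>
    ∑ y ∈ levels P, (mult P y : ℝ) * tiltedMean k θ v' y (fun x => |x - y|) with hD
  set F := ∑ y ∈ levels P, (mult P y : ℝ) * Real.log (tiltedMgf k θ v y s) with hF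
  have hDc : ContinuousOn D (Set.Icc 0 1) := continuousOn_finsetSum _ fun y hy =>
    continuousOn_const.mul ((hθ.admissible hy).continuousOn_tiltedMean hk _)
  have hmem : ∀ l ∈ Set.Icc (0 : ℝ) 1, (1 - l) * θ.u + l * v ∈ Set.Icc (0 : ℝ) 1 := fun l hl =>
    (convex_Icc (0 : ℝ) 1) hu hv (by linarith [hl.2]) hl.1 (by ring)
  have hstep : ∀ l ∈ Set.Ioc (0 : ℝ) 1,
      (1 - v) * (A - B) + (θ.u * A + (1 - θ.u) * B) + s * D ((1 - l) * θ.u + l * v) ≤ F := by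
    intro l hl
    have hvl := hmem l ⟨hl.1.le, hl.2⟩
    have h1 := hS.le_sum_log_tilted hP hk hε hθ hA hB hvl
    have h2 : ∑ y ∈ levels P, (mult P y : ℝ) *
        Real.log (∑ b, tilted k θ ((1 - l) * θ.u + l * v) y b) +
        l * s * D ((1 - l) * θ.u + l * v) ≤ (1 - l) * A + l * F := by
      rw [hA, hF, hD, Finset.mul_sum, Finset.mul_sum, Finset.mul_sum, ← Finset.sum_add_distrib,
        ← Finset.sum_add_distrib]
      refine Finset.sum_le_sum fun y hy => ?_
      have h := hθ.admissible hy
      have h3 := (h.log_tiltedMgf_ge hk hvl.1 (l * s)).trans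
        (h.log_tiltedMgf_interpolate_le hk hu.1 hv.1 hl.1.le hl.2)
      have h4 := mul_le_mul_of_nonneg_left h3 (Nat.cast_nonneg (α := ℝ) (mult P y))
      linarith
    have h5 : l * ((1 - v) * (A - B) + (θ.u * A + (1 - θ.u) * B) +
        s * D ((1 - l) * θ.u + l * v)) ≤ l * F := by linarith
    exact le_of_mul_le_mul_left h5 hl.1
  have hlim : Filter.Tendsto (fun l : ℝ => (1 - v) * (A - B) + (θ.u * A + (1 - θ.u) * B) +
      s * D ((1 - l) * θ.u + l * v)) (nhdsWithin 0 (Set.Ioc 0 1))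
      (nhds ((1 - v) * (A - B) + (θ.u * A + (1 - θ.u) * B) + s * D θ.u)) := by
    have h6 : ContinuousOn (fun l : ℝ => D ((1 - l) * θ.u + l * v)) (Set.Icc 0 1) :=
      hDc.comp (by fun_prop) hmem
    have h7 : Filter.Tendsto (fun l : ℝ => D ((1 - l) * θ.u + l * v)) _ _ :=
      (h6 0 ⟨le_rfl, zero_le_one⟩).tendsto.mono_left
        (nhdsWithin_mono _ Set.Ioc_subset_Icc_self)
    simp only [sub_zero, one_mul, zero_mul, add_zero] at h7
    exact (h7.const_mul s).const_add _
  have hne : (nhdsWithin (0 : ℝ) (Set.Ioc 0 1)).NeBot := by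
    rw [nhdsWithin_Ioc_eq_nhdsGT zero_lt_one]; infer_instance
  have h8 := le_of_tendsto hlim (Filter.eventually_of_mem self_mem_nhdsWithin hstep)
  have h9 := mul_le_mul_of_nonneg_left (hS.attained hP hk hε hθ).2 hs
  linarith

/-! ### The testing problem -/

/-- One of the two errors of any test is at least the smaller of the probabilities that the
likelihood ratio favours the wrong hypothesis. -/
theorem min_error_le_max {α : Type*} {p q T : α → ℝ} {A B : Set α} (hp : ∀ h, 0 ≤ p h)
    (hq : ∀ h, 0 ≤ q h) (hps : Summable p) (hqs : Summable q) (hT : ∀ h, T h ∈ Set.Icc (0 : ℝ) 1)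
    (hA : ∀ h ∈ A, p h ≤ q h) (hB : ∀ h ∈ B, q h ≤ p h) (hAB : Disjoint A B) :
    min (∑' h, A.indicator p h) (∑' h, B.indicator q h) ≤
      max (∑' h, p h * T h) (∑' h, q h * (1 - T h)) := by
  have s1 : Summable (fun h => p h * T h) := Summable.of_nonneg_of_le
    (fun h => mul_nonneg (hp h) (hT h).1) (fun h => mul_le_of_le_one_right (hp h) (hT h).2) hps
  have s2 : Summable (fun h => q h * (1 - T h)) := Summable.of_nonneg_of_le
    (fun h => mul_nonneg (hq h) (by linarith [(hT h).2]))
    (fun h => mul_le_of_le_one_right (hq h) (by linarith [(hT h).1])) hqs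
  have h1 : ∑' h, A.indicator p h + ∑' h, B.indicator q h ≤
      ∑' h, p h * T h + ∑' h, q h * (1 - T h) := by
    rw [← (hps.indicator A).tsum_add (hqs.indicator B), ← s1.tsum_add s2]
    refine ((hps.indicator A).add (hqs.indicator B)).tsum_le_tsum (fun h => ?_) (s1.add s2)
    have hT0 := (hT h).1
    have hT1 : 0 ≤ 1 - T h := by linarith [(hT h).2]
    by_cases ha : h ∈ A
    · have hb : h ∉ B := fun hb => Set.disjoint_left.1 hAB ha hb
      rw [Set.indicator_of_mem ha, Set.indicator_of_notMem hb]
      have := mul_le_mul_of_nonneg_right (hA h ha) hT1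
      linarith
    · by_cases hb : h ∈ B
      · rw [Set.indicator_of_notMem ha, Set.indicator_of_mem hb]
        have := mul_le_mul_of_nonneg_right (hB h hb) hT0
        linarith
      · rw [Set.indicator_of_notMem ha, Set.indicator_of_notMem hb]
        have := mul_nonneg (hp h) hT0
        have := mul_nonneg (hq h) hT1
        linarith
  by_contra! hlt
  rw [max_lt_iff, lt_min_iff, lt_min_iff] at hlt
  linarith [hlt.1.1, hlt.2.2]

section

variable {ι : Type*} [Fintype ι] {P : ι → ℝ} {k ε ε' : ℝ} {θ : Params}

theorem nullProb_pos (hP : IsHypothesis P) (hk : 0 < k) (h : ι → ℕ) : 0 < nullProb P k h :=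
  Finset.prod_pos fun a _ => poi_pos (mul_pos hk (hP.1 a)) _

theorem summable_nullProb (hP : IsHypothesis P) (hk : 0 < k) : Summable (nullProb P k) :=
  (hasSum_pi_prod (fun a => poi (k * P a)) (fun _ => poi_nonneg (mul_pos hk (hP.1 _)).le)
    fun _ => (hasSum_poi _).summable).summable

theorem jointProb_nonneg (hk : 0 < k) (hθ : ∀ a, θ.Admissible (P a)) (h : ι → ℕ) (r : ι → Bool) :
    0 ≤ jointProb P k θ h r :=
  Finset.prod_nonneg fun a _ => mul_nonneg ((hθ a).coin_pos _).le
    (poi_nonneg (mul_nonneg hk.le ((hθ a).mass_nonneg _)) _)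

theorem jointWindowProb_nonneg (hk : 0 < k) (hθ : ∀ a, θ.Admissible (P a)) (h : ι → ℕ) :
    0 ≤ jointWindowProb P k θ ε ε' h :=
  Finset.sum_nonneg fun r _ => by
    split_ifs
    exacts [jointProb_nonneg hk hθ h r, le_rfl]

open Classical in
-- Summed over all coin outcomes the joint probability factorizes into the mixtures; the window only
-- discards nonnegative terms.
theorem jointWindowProb_le (hk : 0 < k) (hθ : ∀ a, θ.Admissible (P a)) (h : ι → ℕ) :
    jointWindowProb P k θ ε ε' h ≤ ∏ a, θ.mix k (P a) (h a) := by
  have h1 : ∏ a, θ.mix k (P a) (h a) = ∑ r : ι → Bool, jointProb P k θ h r := by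
    simp only [jointProb]
    rw [← Fintype.prod_sum fun a b => θ.coin (P a) b * poi (k * θ.mass (P a) b) (h a)]
    refine Finset.prod_congr rfl fun a _ => ?_
    simp [Params.mix, Params.coin, Params.mass]
  rw [h1]
  refine Finset.sum_le_sum fun r _ => ?_
  split_ifs
  exacts [le_rfl, jointProb_nonneg hk hθ h r]

open Classical in
theorem hasSum_jointWindowProb (hk : 0 < k) (hθ : ∀ a, θ.Admissible (P a)) :
    HasSum (jointWindowProb P k θ ε ε')
      (∑ r : ι → Bool, if r ∈ window P θ ε ε' then ∏ a, θ.coin (P a) (r a) else 0) := by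
  refine hasSum_sum fun r _ => ?_
  split_ifs
  · have h := hasSum_pi_prod (fun a i => θ.coin (P a) (r a) * poi (k * θ.mass (P a) (r a)) i)
      (fun a i => mul_nonneg ((hθ a).coin_pos _).le
        (poi_nonneg (mul_nonneg hk.le ((hθ a).mass_nonneg _)) _))
      (fun a => (hasSum_poi _).summable.mul_left _)
    simp only [tsum_mul_left, (hasSum_poi _).tsum_eq, mul_one] at h
    exact h
  · exact hasSum_zero

theorem condProb_nonneg (hk : 0 < k) (hθ : ∀ a, θ.Admissible (P a))
    (hW : 0 < windowProb P k θ ε ε') (h : ι → ℕ) : 0 ≤ condProb P k θ ε ε' h :=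
  div_nonneg (jointWindowProb_nonneg hk hθ h) hW.le

theorem summable_condProb (hk : 0 < k) (hθ : ∀ a, θ.Admissible (P a)) :
    Summable (condProb P k θ ε ε') :=
  (hasSum_jointWindowProb hk hθ).summable.div_const _

theorem chernoffSum_nonneg (hP : IsHypothesis P) (hk : 0 < k) (hθ : ∀ a, θ.Admissible (P a))
    (hW : 0 < windowProb P k θ ε ε') (v : ℝ) : 0 ≤ chernoffSum P k θ ε ε' v := by
  refine tsum_nonneg fun h => ?_
  split_ifs
  · exact le_rfl
  · exact mul_nonneg (Real.rpow_nonneg (nullProb_pos hP hk h).le _)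
      (Real.rpow_nonneg (condProb_nonneg hk hθ hW h) _)

theorem min_errors_le_failureProb (hP : IsHypothesis P) (hk : 0 < k)
    (hθ : ∀ a, θ.Admissible (P a)) (hW : 0 < windowProb P k θ ε ε') {T : (ι → ℕ) → ℝ}
    (hT : ∀ h, T h ∈ Set.Icc (0 : ℝ) 1) :
    min (∑' h : ι → ℕ, {h | 0 < logRatio P k θ ε ε' h}.indicator (nullProb P k) h)
      (∑' h : ι → ℕ, {h | logRatio P k θ ε ε' h < 0}.indicator (condProb P k θ ε ε') h) ≤
      failureProb P k θ ε ε' T := by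
  refine min_error_le_max (fun h => (nullProb_pos hP hk h).le) (condProb_nonneg hk hθ hW)
    (summable_nullProb hP hk) (summable_condProb hk hθ) hT (fun h hh => ?_) (fun h hh => ?_)
    (Set.disjoint_left.2 fun h (h1 : 0 < logRatio P k θ ε ε' h)
      (h2 : logRatio P k θ ε ε' h < 0) => lt_asymm h1 h2)
  · have hn := nullProb_pos hP hk h
    by_contra! hlt
    exact absurd hh (not_lt.2 (Real.log_nonpos (div_nonneg (condProb_nonneg hk hθ hW h) hn.le)
      ((div_le_one hn).2 hlt.le)))
  · have hn := nullProb_pos hP hk h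
    by_contra! hlt
    exact absurd hh (not_lt.2 (Real.log_nonneg ((one_le_div hn).2 hlt.le)))

theorem ch₁_nonneg (hP : IsHypothesis P) (hk : 0 < k) (hθ : ∀ a, θ.Admissible (P a))
    (hW : 0 < windowProb P k θ ε ε') : 0 ≤ ch₁ P k θ ε ε' :=
  div_nonneg (le_min
    (tsum_nonneg fun h => Set.indicator_nonneg (fun h _ => (nullProb_pos hP hk h).le) h)
    (tsum_nonneg fun h => Set.indicator_nonneg (fun h _ => condProb_nonneg hk hθ hW h) h))
    (Real.iInf_nonneg fun v => chernoffSum_nonneg hP hk hθ hW v)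

theorem ch₁_mul_chernoffSum_le (hP : IsHypothesis P) (hk : 0 < k)
    (hθ : ∀ a, θ.Admissible (P a)) (hW : 0 < windowProb P k θ ε ε') {v : ℝ}
    (hv : v ∈ Set.Icc (0 : ℝ) 1)
    (hvmin : IsMinOn (chernoffSum P k θ ε ε') (Set.Icc (0 : ℝ) 1) v) {T : (ι → ℕ) → ℝ}
    (hT : ∀ h, T h ∈ Set.Icc (0 : ℝ) 1) :
    ch₁ P k θ ε ε' * chernoffSum P k θ ε ε' v ≤ failureProb P k θ ε ε' T := by
  have hinf : ⨅ v : Set.Icc (0 : ℝ) 1, chernoffSum P k θ ε ε' v = chernoffSum P k θ ε ε' v := by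
    have : Nonempty (Set.Icc (0 : ℝ) 1) := ⟨⟨v, hv⟩⟩
    refine le_antisymm (ciInf_le ⟨0, ?_⟩ (⟨v, hv⟩ : Set.Icc (0 : ℝ) 1))
      (le_ciInf fun w => hvmin w.2)
    rintro _ ⟨w, rfl⟩
    exact chernoffSum_nonneg hP hk hθ hW w
  refine le_trans ?_ (min_errors_le_failureProb hP hk hθ hW hT)
  rw [ch₁, hinf]
  -- If the Chernoff sum vanishes, the left side is 0 and only nonnegativity of the two error
  -- probabilities is needed.
  rcases (chernoffSum_nonneg hP hk hθ hW v).eq_or_lt with h0 | h0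
  · rw [← h0, mul_zero]
    exact le_min
      (tsum_nonneg fun h => Set.indicator_nonneg (fun h _ => (nullProb_pos hP hk h).le) h)
      (tsum_nonneg fun h => Set.indicator_nonneg (fun h _ => condProb_nonneg hk hθ hW h) h)
  · rw [div_mul_cancel₀ _ h0.ne']

open Classical in
/-- The numerator of `ch₂` bounds the Chernoff sum from below. -/
theorem rpow_mul_sum_tilted_le_chernoffSum (hP : IsHypothesis P) (hk : 0 < k)
    (hθ : ∀ a, θ.Admissible (P a)) (hW : 0 < windowProb P k θ ε ε') {v : ℝ}
    (hv : v ∈ Set.Icc (0 : ℝ) 1) :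
    windowProb P k θ ε ε' ^ (v - 1) *
      (∑ r : ι → Bool, if r ∈ window P θ ε ε' then ∏ a, tilted k θ v (P a) (r a) else 0) ≤
      chernoffSum P k θ ε ε' v := by
  set ω := windowProb P k θ ε ε' with hω
  have hsum : HasSum (fun h : ι → ℕ =>
      jointWindowProb P k θ ε ε' h * ∏ a, θ.weight k v (P a) (h a))
      (∑ r : ι → Bool, if r ∈ window P θ ε ε' then ∏ a, tilted k θ v (P a) (r a) else 0) := by
    simp only [jointWindowProb, Finset.sum_mul]
    refine hasSum_sum fun r _ => ?_
    split_ifs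
    · have h := hasSum_pi_prod (fun a i => θ.coin (P a) (r a) *
        (θ.weight k v (P a) i * poi (k * θ.mass (P a) (r a)) i))
        (fun a i => mul_nonneg ((hθ a).coin_pos _).le (mul_nonneg ((hθ a).weight_pos hk i).le
          (poi_nonneg (mul_nonneg hk.le ((hθ a).mass_nonneg _)) _)))
        (fun a => (((hθ a).expGrowth_weight hk hv.1).summable _).mul_left _)
      simp only [tsum_mul_left] at h
      have he : ∀ a, θ.coin (P a) (r a) * ∑' i, θ.weight k v (P a) i *
          poi (k * θ.mass (P a) (r a)) i = tilted k θ v (P a) (r a) := fun a =>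
        ((hθ a).tilted_eq hk v (r a)).symm
      simp only [he] at h
      refine h.congr_fun fun x => ?_
      rw [jointProb, ← Finset.prod_mul_distrib]
      exact Finset.prod_congr rfl fun a _ => by ring
    · simp
  have hterm : ∀ h : ι → ℕ, 0 ≤ (if condProb P k θ ε ε' h = 0 then 0
      else nullProb P k h ^ v * condProb P k θ ε ε' h ^ (1 - v)) := fun h => by
    split_ifs
    · exact le_rfl
    · exact mul_nonneg (Real.rpow_nonneg (nullProb_pos hP hk h).le _)
        (Real.rpow_nonneg (condProb_nonneg hk hθ hW h) _)
  have hsF : Summable (fun h : ι → ℕ => if condProb P k θ ε ε' h = 0 then 0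
      else nullProb P k h ^ v * condProb P k θ ε ε' h ^ (1 - v)) := by
    refine Summable.of_nonneg_of_le hterm (fun h => ?_)
      (((summable_nullProb hP hk).mul_left v).add
        ((summable_condProb hk hθ (ε := ε) (ε' := ε')).mul_left (1 - v)))
    have h1 := (nullProb_pos hP hk h).le
    have h2 := condProb_nonneg hk hθ hW h
    have h3 : 0 ≤ 1 - v := by linarith [hv.2]
    split_ifs
    · exact add_nonneg (mul_nonneg hv.1 h1) (mul_nonneg h3 h2)
    · exact Real.geom_mean_le_arith_mean2_weighted hv.1 h3 h1 h2 (by ring)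
  refine hasSum_le (fun h => ?_) (hsum.mul_left (ω ^ (v - 1))) hsF.hasSum
  have hJ0 := jointWindowProb_nonneg (ε := ε) (ε' := ε') hk hθ h
  split_ifs with hc
  · have : jointWindowProb P k θ ε ε' h = 0 := (div_eq_zero_iff.1 hc).resolve_right hW.ne'
    rw [this]; simp
  · set J := jointWindowProb P k θ ε ε' h with hJ
    have hJpos : 0 < J := lt_of_le_of_ne hJ0 fun h0 => hc (by rw [condProb, ← hJ, ← h0, zero_div])
    have hM : 0 < ∏ a, θ.mix k (P a) (h a) := Finset.prod_pos fun a _ => (hθ a).mix_pos hk _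
    have hw : ∏ a, θ.weight k v (P a) (h a) =
        nullProb P k h ^ v * (∏ a, θ.mix k (P a) (h a)) ^ (-v) := by
      simp only [Params.weight]
      rw [Real.finsetProd_rpow _ _ (fun a _ => ((hθ a).ratio_pos hk _).le),
        Finset.prod_div_distrib, ← nullProb,
        Real.div_rpow (nullProb_pos hP hk h).le hM.le, Real.rpow_neg hM.le, div_eq_mul_inv]
    -- The factorized mixture may replace the nonfactorizing J because the exponent -v is
    -- nonpositive.
    have hMJ : (∏ a, θ.mix k (P a) (h a)) ^ (-v) ≤ J ^ (-v) :=
      Real.rpow_le_rpow_of_nonpos hJpos (jointWindowProb_le hk hθ h) (by linarith [hv.1])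
    have hcond : condProb P k θ ε ε' h ^ (1 - v) = ω ^ (v - 1) * (J * J ^ (-v)) := by
      rw [condProb, ← hJ, ← hω, Real.div_rpow hJ0 hW.le, sub_eq_add_neg 1 v,
        Real.rpow_add hJpos, Real.rpow_one, ← sub_eq_add_neg, ← neg_sub v 1, Real.rpow_neg hW.le]
      field_simp
    rw [hw, hcond]
    have hn := Real.rpow_nonneg (nullProb_pos hP hk h).le v
    have hωv := Real.rpow_nonneg hW.le (v - 1)
    calc _ ≤ ω ^ (v - 1) * (J * (nullProb P k h ^ v * J ^ (-v))) := by gcongr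
      _ = _ := by ring

/-- Markov's inequality in exponential form: on the window the distance is at most ε', so
exp(α(distance - ε')) ≥ 1 as α ≤ 0. -/
theorem windowProb_le (hk : 0 < k) (hθ : ∀ a, θ.Admissible (P a)) (hα : θ.α ≤ 0) :
    windowProb P k θ ε ε' ≤ Real.exp (-θ.α * ε') *
      ∏ a, ∑ b, θ.coin (P a) b * Real.exp (θ.α * |θ.mass (P a) b - P a|) := by
  classical
  rw [windowProb, (hasSum_jointWindowProb hk hθ).tsum_eq, Fintype.prod_sum, Finset.mul_sum]
  refine Finset.sum_le_sum fun r _ => ?_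
  have hc : 0 < ∏ a, θ.coin (P a) (r a) := Finset.prod_pos fun a _ => (hθ a).coin_pos _
  rw [Finset.prod_mul_distrib, ← Real.exp_sum, ← Finset.mul_sum]
  split_ifs with hr
  · rw [mul_left_comm, ← Real.exp_add]
    refine le_mul_of_one_le_right hc.le (Real.one_le_exp ?_)
    have := mul_le_mul_of_nonpos_left hr.2 hα
    linarith
  · positivity

open Classical in
theorem IsOptimal.exp_mul_ch₂_le_chernoffSum (hP : IsHypothesis P) (hk : 0 < k) (hε : 0 < ε)
    (hε' : ε ≤ ε') (hθ : IsOptimal P k ε θ) (hW : 0 < windowProb P k θ ε ε') {S : ℝ → ℝ}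
    (hS : IsSupValue P k ε θ S) {v : ℝ} (hv : v ∈ Set.Icc (0 : ℝ) 1) :
    Real.exp (mergedValue P ε θ.α θ.u (fun y => Real.log (∑ b, tilted k θ θ.u y b)) S) *
      (ch₂ P k θ ε ε' v * Real.exp (θ.α * (ε' - ε))) ≤ chernoffSum P k θ ε ε' v := by
  have hadm : ∀ a, θ.Admissible (P a) := fun a =>
    hθ.admissible (Finset.mem_image_of_mem P (Finset.mem_univ a))
  have hu0 := hθ.u_mem.1
  set A := ∑ y ∈ levels P, (mult P y : ℝ) * Real.log (∑ b, tilted k θ θ.u y b) with hA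
  set B := ε * θ.α + ∑ y ∈ levels P, (mult P y : ℝ) * S y with hB
  set ω := windowProb P k θ ε ε' with hω
  -- Since both outcomes attain the supremum, exp(α|x_b - y|) is the Poisson mean of the weight at
  -- x_b divided by exp(S y). The product in the Markov bound thus collapses to the ratio of Z_y(u)
  -- to exp(S y) over all elements.
  have hωle : ω ≤ Real.exp ((A - B) - θ.α * (ε' - ε)) := by
    refine (windowProb_le hk hadm hθ.α_nonpos).trans_eq ?_
    have h1 : ∀ a, ∑ b, θ.coin (P a) b * Real.exp (θ.α * |θ.mass (P a) b - P a|) =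
        Real.exp (Real.log (∑ b, tilted k θ θ.u (P a) b) - S (P a)) := fun a => by
      rw [Real.exp_sub, Real.exp_log ((hadm a).sum_tilted_pos hk hu0), Finset.sum_div]
      refine Finset.sum_congr rfl fun b _ => ?_
      rw [(hadm a).tilted_eq hk, (hS.attained hP hk hε hθ).1 _
        (Finset.mem_image_of_mem P (Finset.mem_univ a)), Real.exp_add]
      field_simp
    simp only [h1]
    rw [← Real.exp_sum, ← Real.exp_add, Finset.sum_sub_distrib, ← sum_levels P S,
      ← sum_levels P fun y => Real.log (∑ b, tilted k θ θ.u y b), ← hA]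
    congr 1
    rw [hB]; ring
  have hden : Real.exp ((1 - v) * (A - B) + (θ.u * A + (1 - θ.u) * B)) ≤
      ⨅ s : Set.Ici (0 : ℝ), Real.exp (-(s : ℝ) * ε) *
        ∏ a, ∑ b : Bool, Real.exp ((s : ℝ) * |θ.mass (P a) b - P a|) * tilted k θ v (P a) b := by
    have : Nonempty (Set.Ici (0 : ℝ)) := ⟨⟨0, Set.self_mem_Ici⟩⟩
    refine le_ciInf fun s => ?_
    have h1 : ∀ a, ∑ b : Bool, Real.exp ((s : ℝ) * |θ.mass (P a) b - P a|) * tilted k θ v (P a) b =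
        Real.exp (Real.log (tiltedMgf k θ v (P a) s)) := fun a =>
      (Real.exp_log ((hadm a).tiltedMgf_pos hk hv.1 s)).symm
    simp only [h1]
    rw [← Real.exp_sum, ← Real.exp_add, ← sum_levels P fun y => Real.log (tiltedMgf k θ v y s)]
    exact Real.exp_le_exp.2 (hS.le_log_tiltedMgf hP hk hε hθ hA hB hv s.2)
  refine le_trans ?_ (rpow_mul_sum_tilted_le_chernoffSum hP hk hadm hW hv)
  rw [mergedValue_eq, ← hA, ← hB, ch₂]
  set num := ∑ r : ι → Bool, if r ∈ window P θ ε ε' then ∏ a, tilted k θ v (P a) (r a) else 0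
  have hnum0 : 0 ≤ num := Finset.sum_nonneg fun r _ => by
    split_ifs
    · exact Finset.prod_nonneg fun a _ => ((hadm a).tilted_pos hk hv.1 _).le
    · exact le_rfl
  -- Raising the bound on ω to the power v - 1 yields (1-v)α(ε'-ε), which is at least α(ε'-ε)
  -- because α ≤ 0.
  have hωpow : Real.exp (-((1 - v) * (A - B)) + θ.α * (ε' - ε)) ≤ ω ^ (v - 1) := by
    refine le_trans ?_ (Real.rpow_le_rpow_of_nonpos hW hωle (by linarith [hv.2]))
    rw [← Real.exp_mul, Real.exp_le_exp]
    have := mul_nonneg hv.1 (mul_nonneg (neg_nonneg.2 hθ.α_nonpos) (sub_nonneg.2 hε'))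
    linarith
  calc _ ≤ Real.exp (θ.u * A + (1 - θ.u) * B) *
        (num / Real.exp ((1 - v) * (A - B) + (θ.u * A + (1 - θ.u) * B)) *
          Real.exp (θ.α * (ε' - ε))) := by gcongr
    _ = Real.exp (-((1 - v) * (A - B)) + θ.α * (ε' - ε)) * num := by
      simp only [Real.exp_add, Real.exp_neg]
      field_simp
    _ ≤ _ := by gcongr

end

end IdentityTesting

theorem mainTheorem4 {ι : Type*} [Fintype ι] (P : ι → ℝ) (hP : IsHypothesis P)
    (k ε ε' : ℝ) (hk : 0 < k) (hε : 0 < ε) (hε' : ε ≤ ε')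
    (θ : Params) (hθ : IsOptimal P k ε θ)
    -- the conditional distribution is well defined
    (hW : 0 < windowProb P k θ ε ε')
    -- `v` is an optimal exponent in the Chernoff bound on the likelihood ratio
    (v : ℝ) (hv : v ∈ Set.Icc (0 : ℝ) 1)
    (hvmin : IsMinOn (chernoffSum P k θ ε ε') (Set.Icc (0 : ℝ) 1) v)
    -- an arbitrary, possibly randomized tester
    (T : (ι → ℕ) → ℝ) (hT : ∀ h, T h ∈ Set.Icc (0 : ℝ) 1) :
    -- the upper bound as the value of the merged optimization problem
    EReal.exp (mergedObjective P k ε θ.α θ.u (θ.kappa k)) *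
        ENNReal.ofReal (ch₁ P k θ ε ε' * ch₂ P k θ ε ε' v * Real.exp (θ.α * (ε' - ε))) ≤
      ENNReal.ofReal (failureProb P k θ ε ε' T) ∧
    -- the upper bound as `Δ(P, k, ε)`
    EReal.exp (Delta P k ε) *
        ENNReal.ofReal (ch₁ P k θ ε ε' * ch₂ P k θ ε ε' v * Real.exp (θ.α * (ε' - ε))) ≤
      ENNReal.ofReal (failureProb P k θ ε ε' T) := by
  have hadm : ∀ a, θ.Admissible (P a) := fun a =>
    hθ.admissible (Finset.mem_image_of_mem P (Finset.mem_univ a))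
  obtain ⟨S, hS⟩ := hθ.exists_isSupValue hP hk hε
  have hΔ : Delta P k ε ≤ mergedObjective P k ε θ.α θ.u (θ.kappa k) := by
    rw [hS.value]
    exact Delta_le hP hθ.α_nonpos hθ.u_mem
      (fun y hy => ((hθ.admissible hy).logMgf_one_sub_kappa hk hθ.u_mem.1 fun i => rfl).le)
      (fun y hy x => hS.logMgf_le hk hθ hy (fun i => rfl) x)
  have hmain : EReal.exp (mergedObjective P k ε θ.α θ.u (θ.kappa k)) *
      ENNReal.ofReal (ch₁ P k θ ε ε' * ch₂ P k θ ε ε' v * Real.exp (θ.α * (ε' - ε))) ≤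
      ENNReal.ofReal (failureProb P k θ ε ε' T) := by
    rw [hS.value, EReal.exp_coe, ← ENNReal.ofReal_mul (Real.exp_pos _).le]
    refine ENNReal.ofReal_le_ofReal
      (le_trans ?_ (ch₁_mul_chernoffSum_le hP hk hadm hW hv hvmin hT))
    have h1 := mul_le_mul_of_nonneg_left
      (hθ.exp_mul_ch₂_le_chernoffSum hP hk hε hε' hW hS hv) (ch₁_nonneg hP hk hadm hW)
    refine le_trans (le_of_eq ?_) h1
    ring
  exact ⟨hmain, (mul_le_mul_left (EReal.exp_monotone hΔ) _).trans hmain⟩
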